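/- Let $k$ be a field and let $A=\bigoplus_{n\ge 0}A_n$ be a connected ($A_0=k$), $\mathbb N$-graded, locally finite-dimensional, left noetherian $k$-algebra that is Artin–Schelter regular of dimension $d$: the global dimension of $A$ is $d$, $\operatorname{Ext}^i_A(k,A)=0$ for $i\neq d$, and $\operatorname{Ext}^d_A(k,A)$ is one-dimensional, where $k=A/A_+$ is the trivial left module (no condition on the Gelfand–Kirillov dimension is needed). Let $f\in A$ be a homogeneous normal regular element of degree $e>0$ (that is, $Af=fA$ and $f$ is not a left or right zero divisor), let $\sigma$ be its normalizing automorphism, the graded $k$-algebra automorphism of $A$ determined by $af=f\sigma(a)$, and let $|\sigma|$ be its order. Let $B=A/(f)$. *Conventions.* Modules are $\mathbb Z$-graded left modules, homomorphisms have degree $0$, free means having a homogeneous basis, and $M(n)_i=M_{i+n}$. For a graded $A$-module $M$ let $M^{tw}=M^{\sigma}(-e)$, where $M^\sigma$ is $M$ with the action $a\cdot m=\sigma(a)m$, and let $\lambda_f^M:M^{tw}\to M$ be left multiplication by $f$. A *twisted left matrix factorization* of $f$ over $A$ is a pair $(\varphi:F\to G,\ \tau:G^{tw}\to F)$ of homomorphisms,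 with $F,G$ finitely generated graded free $A$-modules, such that $\varphi\tau=\lambda_f^G$ and $\tau\varphi^{tw}=\lambda_f^F$. An isomorphism $(\varphi,\tau)\to(\varphi',\tau')$ is a pair of isomorphisms $F\to F'$, $G\to G'$ that commutes with $\varphi,\varphi'$; direct sums are formed componentwise. A factorization is *trivial* if $\varphi=\lambda_f^{A(n)}$ or $\tau=\lambda_f^{A(n)}$ for some $n\in\mathbb Z$, and $(\varphi,\tau)$ is *reduced* if it is not isomorphic to a factorization having a trivial direct summand. $\mathbf\Omega(\varphi,\tau)$ denotes the complex of graded $B$-modules obtained by reducing $$\cdots\to G^{tw^2}\xrightarrow{\tau^{tw}}F^{tw}\xrightarrow{\varphi^{tw}}G^{tw}\xrightarrow{\tau}F\xrightarrow{\varphi}G$$ modulo $f$, with $G/fG$ in homological degree $0$. A resolution $(\mathbf Q,\partial)$ over $B$ is *minimal* if $\operatorname{im}\partial_i\subseteq B_+Q_{i-1}$ for all $i\geq 1$. A complex $\mathbf P:\cdots\to P_1\to P_0$ is *periodic of period $p$* if $p$ is the smallest positive integer for which there are an integer $n$ and a morphism of complexes $t:\mathbf P(n)\to\mathbf P$ of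 homological degree $-p$ such that $t:P_{i+p}(n)\to P_i$ is an isomorphism for all $i\ge 0$; it is *periodic* if such a $p$ exists. **Theorem.** Let $\mathbf Q:\cdots\to Q_2\to Q_1\to Q_0$ be a minimal graded free left $B$-module resolution of a finitely generated graded left $B$-module $M$. Then: 1. The truncated complex $\cdots\to Q_{d+2}\to Q_{d+1}$ is chain isomorphic to $\mathbf\Omega(\varphi,\tau)$ for some reduced twisted left matrix factorization $(\varphi,\tau)$ of $f$ over $A$. Assume further that $|\sigma|<\infty$. Then: 2. The truncated complex $\cdots\to Q_{d+2}\to Q_{d+1}$ is periodic of period at most $2|\sigma|$. 3. If $M\neq 0$, then $\mathbf Q$ is periodic if and only if $\operatorname{pd}_A(M)=1$ and $M$ has no nonzero graded free $B$-module direct summand; and $\mathbf Q$ is periodic of period at most $2|\sigma|$ under exactly the same condition. 4. If $\mathbf Q$ is periodic, then $\mathbf Q$ is chain isomorphic to $\mathbf\Omega(\varphi,\tau)$ for some reduced twisted left matrix factorization $(\varphi,\tau)$ of $f$ over $A$. -/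

import Mathlib

open CategoryTheory

universe v u

/-! ### Internal direct sums -/

/-- An internal direct sum decomposition yields its family of projections. -/
theorem exists_proj_of_isInternal {M : Type*} [AddCommGroup M] {ℳ : ℤ → AddSubgroup M}
    (h : DirectSum.IsInternal ℳ) :
    ∃ π : ℤ → M →+ M, (∀ i x, π i x ∈ ℳ i) ∧ (∀ i x, x ∈ ℳ i → π i x = x) ∧
      (∀ i j x, x ∈ ℳ j → j ≠ i → π i x = 0) := by
  classical
  let _ : DirectSum.Decomposition ℳ := h.chooseDecomposition
  refine ⟨fun i => (ℳ i).subtype.comp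
    ((DFinsupp.evalAddMonoidHom i).comp (DirectSum.decomposeAddEquiv ℳ).toAddMonoidHom), ?_, ?_, ?_⟩
  · intro i x
    exact SetLike.coe_mem _
  · intro i x hx
    exact DirectSum.decompose_of_mem_same ℳ hx
  · intro i j x hx hij
    exact DirectSum.decompose_of_mem_ne ℳ hx hij

/-- A criterion for an internal direct sum decomposition in terms of projections. -/
theorem isInternal_of_proj {M : Type*} [AddCommGroup M] {ℳ : ℤ → AddSubgroup M}
    (π : ℤ → M →+ M) (h1 : ∀ i x, x ∈ ℳ i → π i x = x)
    (h2 : ∀ i j x, x ∈ ℳ j → j ≠ i → π i x = 0) (htop : ⨆ i, ℳ i = ⊤) :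
    DirectSum.IsInternal ℳ := by
  classical
  have key : ∀ (i : ℤ) (y : DirectSum ℤ fun j => ℳ j),
      π i (DirectSum.coeAddMonoidHom ℳ y) = (y i : M) := by
    intro i y
    induction y using DirectSum.induction_on with
    | zero => simp
    | of j x =>
      rw [DirectSum.coeAddMonoidHom_of]
      by_cases hij : j = i
      · subst hij
        rw [DirectSum.of_eq_same]
        exact h1 _ _ x.2
      · rw [DirectSum.of_eq_of_ne _ _ _ (Ne.symm hij), h2 i j _ x.2 hij]
        rfl
    | add y z hy hz => simp [hy, hz]
  constructor
  · rw [injective_iff_map_eq_zero]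
    intro y hy
    refine DFinsupp.ext fun i => Subtype.ext ?_
    have := key i y
    rw [hy, map_zero] at this
    exact this.symm
  · rw [← AddMonoidHom.range_eq_top, eq_top_iff, ← htop, iSup_le_iff]
    intro i x hx
    exact ⟨DirectSum.of (fun j => ℳ j) i ⟨x, hx⟩, DirectSum.coeAddMonoidHom_of _ _ _⟩

theorem iSup_eq_top_of_isInternal {M : Type*} [AddCommGroup M] {ℳ : ℤ → AddSubgroup M}
    (h : DirectSum.IsInternal ℳ) : ⨆ i, ℳ i = ⊤ :=
  by
  rw [eq_top_iff]
  rintro x -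
  obtain ⟨y, rfl⟩ := h.2 x
  induction y using DirectSum.induction_on with
  | zero => simp
  | of j x =>
    rw [DirectSum.coeAddMonoidHom_of]
    exact AddSubgroup.mem_iSup_of_mem j x.2
  | add y z hy hz =>
    rw [map_add]
    exact add_mem hy hz

/-! ### The category of graded left modules -/

/-- A `ℤ`-graded left module over a ring `R` graded by `𝓡 : ℕ → S`. -/
structure GrMod {R : Type u} [Ring R] {S : Type*} [SetLike S R] (𝓡 : ℕ → S) where
  carrier : Type u
  [addCommGroup : AddCommGroup carrier]
  [module : Module R carrier]
  grading : ℤ → AddSubgroup carrier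
  isInternal : DirectSum.IsInternal grading
  smul_mem : ∀ {i : ℕ} {j : ℤ} {a : R} {m : carrier},
    a ∈ 𝓡 i → m ∈ grading j → a • m ∈ grading (i + j)

attribute [instance] GrMod.addCommGroup GrMod.module

namespace GrMod

section Basic

variable {R : Type u} [Ring R] {S : Type*} [SetLike S R] {𝓡 : ℕ → S}

/-- Homomorphisms of graded modules: linear maps of degree `0`. -/
@[ext]
structure Hom (M N : GrMod 𝓡) where
  lin : M.carrier →ₗ[R] N.carrier
  map_mem : ∀ {i : ℤ} {m : M.carrier}, m ∈ M.grading i → lin m ∈ N.grading i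

instance : Category (GrMod 𝓡) where
  Hom M N := Hom M N
  id M := ⟨LinearMap.id, fun h => h⟩
  comp φ ψ := ⟨ψ.lin.comp φ.lin, fun h => ψ.map_mem (φ.map_mem h)⟩

@[ext]
theorem hom_ext {M N : GrMod 𝓡} {φ ψ : M ⟶ N} (h : ∀ x, φ.lin x = ψ.lin x) : φ = ψ :=
  Hom.ext (LinearMap.ext h)

@[simp]
theorem id_lin (M : GrMod 𝓡) : (𝟙 M : M ⟶ M).lin = LinearMap.id := rfl

@[simp]
theorem comp_lin {M N P : GrMod 𝓡} (φ : M ⟶ N) (ψ : N ⟶ P) :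
    (φ ≫ ψ).lin = ψ.lin.comp φ.lin := rfl

instance (M N : GrMod 𝓡) : Zero (M ⟶ N) := ⟨⟨0, fun _ => zero_mem _⟩⟩

@[simp]
theorem zero_lin (M N : GrMod 𝓡) : (0 : M ⟶ N).lin = 0 := rfl

instance : Limits.HasZeroMorphisms (GrMod 𝓡) where
  comp_zero _ _ := by ext; simp
  zero_comp _ _ _ _ := by ext; simp

/-- A graded free module: one with a basis of homogeneous elements. -/
def IsFree (M : GrMod 𝓡) : Prop :=
  ∃ (ι : Type u) (b : Module.Basis ι R M.carrier), ∀ i, ∃ n, b i ∈ M.grading n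

/-- The degree shift `M(n)`, with `M(n)_i = M_{i+n}`. -/
def shift (n : ℤ) (M : GrMod 𝓡) : GrMod 𝓡 where
  carrier := M.carrier
  grading i := M.grading (i + n)
  isInternal := by
    obtain ⟨π, -, h1, h2⟩ := exists_proj_of_isInternal M.isInternal
    refine isInternal_of_proj (fun i => π (i + n)) (fun i x hx => h1 _ x hx)
      (fun i j x hx hij => h2 _ _ x hx (by omega)) ?_
    rw [← iSup_eq_top_of_isInternal M.isInternal]
    exact (Equiv.addRight n).iSup_comp (g := M.grading)
  smul_mem := by
    intro i j a m ha hm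
    rw [add_assoc]
    exact M.smul_mem ha hm

/-- The degree shift on morphisms. -/
def shiftMap (n : ℤ) {M N : GrMod 𝓡} (φ : M ⟶ N) : M.shift n ⟶ N.shift n :=
  ⟨φ.lin, fun h => φ.map_mem h⟩

/-- The direct sum of two graded modules. -/
def prod (M N : GrMod 𝓡) : GrMod 𝓡 where
  carrier := M.carrier × N.carrier
  grading i := (M.grading i).prod (N.grading i)
  isInternal := by
    obtain ⟨π, -, h1, h2⟩ := exists_proj_of_isInternal M.isInternal
    obtain ⟨ρ, -, k1, k2⟩ := exists_proj_of_isInternal N.isInternal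
    refine isInternal_of_proj (fun i => (π i).prodMap (ρ i))
      (fun i x hx => Prod.ext (h1 _ _ hx.1) (k1 _ _ hx.2))
      (fun i j x hx hij => Prod.ext (h2 _ _ _ hx.1 hij) (k2 _ _ _ hx.2 hij)) ?_
    rw [eq_top_iff]
    rintro ⟨x, y⟩ -
    have hx : (⨆ i, M.grading i) ≤ (⨆ i, (M.grading i).prod (N.grading i)).comap
        (AddMonoidHom.inl M.carrier N.carrier) := by
      refine iSup_le fun i z hz => ?_
      exact AddSubgroup.mem_iSup_of_mem i ⟨hz, zero_mem _⟩
    have hy : (⨆ i, N.grading i) ≤ (⨆ i, (M.grading i).prod (N.grading i)).comap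
        (AddMonoidHom.inr M.carrier N.carrier) := by
      refine iSup_le fun i z hz => ?_
      exact AddSubgroup.mem_iSup_of_mem i ⟨zero_mem _, hz⟩
    rw [iSup_eq_top_of_isInternal M.isInternal] at hx
    rw [iSup_eq_top_of_isInternal N.isInternal] at hy
    have h3 : ((x, 0) : M.carrier × N.carrier) + (0, y) ∈
        ⨆ i, (M.grading i).prod (N.grading i) :=
      add_mem (hx (AddSubgroup.mem_top x)) (hy (AddSubgroup.mem_top y))
    rwa [Prod.mk_add_mk, add_zero, zero_add] at h3
  smul_mem ha hm := ⟨M.smul_mem ha hm.1, N.smul_mem ha hm.2⟩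

/-- The direct sum of two morphisms. -/
def prodMap {M N M' N' : GrMod 𝓡} (φ : M ⟶ N) (ψ : M' ⟶ N') : M.prod M' ⟶ N.prod N' :=
  ⟨φ.lin.prodMap ψ.lin, fun h => ⟨φ.map_mem h.1, ψ.map_mem h.2⟩⟩

theorem IsFree.shift {M : GrMod 𝓡} (hM : M.IsFree) (n : ℤ) : (M.shift n).IsFree := by
  obtain ⟨ι, b, hb⟩ := hM
  refine ⟨ι, b, fun i => ?_⟩
  obtain ⟨m, hm⟩ := hb i
  exact ⟨m - n, show b i ∈ M.grading (m - n + n) by rwa [sub_add_cancel]⟩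

theorem IsFree.prod {M N : GrMod 𝓡} (hM : M.IsFree) (hN : N.IsFree) : (M.prod N).IsFree := by
  obtain ⟨ι, b, hb⟩ := hM
  obtain ⟨κ, c, hc⟩ := hN
  refine ⟨ι ⊕ κ, b.prod c, ?_⟩
  rintro (i | i)
  · obtain ⟨n, hn⟩ := hb i
    have h1 : b.prod c (Sum.inl i) = (b i, 0) := by simp [Module.Basis.prod_apply]
    exact ⟨n, h1 ▸ (⟨hn, zero_mem _⟩ : (b i, (0 : N.carrier)) ∈ (M.grading n).prod (N.grading n))⟩
  · obtain ⟨n, hn⟩ := hc i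
    have h1 : b.prod c (Sum.inr i) = (0, c i) := by simp [Module.Basis.prod_apply]
    exact ⟨n, h1 ▸ (⟨zero_mem _, hn⟩ : ((0 : M.carrier), c i) ∈ (M.grading n).prod (N.grading n))⟩

/-- `M` has a nonzero graded free direct summand (in the category of graded modules). -/
def HasFreeSummand (M : GrMod 𝓡) : Prop :=
  ∃ N F : GrMod 𝓡, F.IsFree ∧ Nontrivial F.carrier ∧ Nonempty (M ≅ N.prod F)

/-- The submodule `R₊ M`, where `R₊` is the sum of the components of positive degree of `R`. -/
def posPart (M : GrMod 𝓡) : Submodule R M.carrier :=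
  Submodule.span R {y | ∃ n : ℕ, 0 < n ∧ ∃ a ∈ 𝓡 n, ∃ x : M.carrier, a • x = y}

/-! ### Complexes, resolutions and periodicity -/

/-- `Q`, together with `ε : Q₀ ⟶ M`, is a minimal graded free resolution of `M`. -/
structure IsMinimalFreeResolution {M : GrMod 𝓡} (Q : ChainComplex (GrMod 𝓡) ℕ)
    (ε : Q.X 0 ⟶ M) : Prop where
  free : ∀ i, (Q.X i).IsFree
  surjective : Function.Surjective ε.lin
  exact_zero : LinearMap.ker ε.lin = LinearMap.range (Q.d 1 0).lin
  exact_succ : ∀ i, LinearMap.ker (Q.d (i + 1) i).lin = LinearMap.range (Q.d (i + 2) (i + 1)).lin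
  minimal : ∀ i, LinearMap.range (Q.d (i + 1) i).lin ≤ (Q.X i).posPart

/-- The truncated complex `⋯ → P_{m+2} → P_{m+1} → P_m`, with `P_m` placed in homological
degree `0`. -/
def truncation (P : ChainComplex (GrMod 𝓡) ℕ) (m : ℕ) : ChainComplex (GrMod 𝓡) ℕ where
  X i := P.X (i + m)
  d i j := P.d (i + m) (j + m)
  shape i j hij := P.shape _ _ fun h => hij (by
    simp only [ComplexShape.down_Rel] at h ⊢
    omega)
  d_comp_d' _ _ _ _ _ := P.d_comp_d _ _ _

/-- There are an integer `n` and a chain map `t : P(n) → P` of homological degree `-p` such that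
`t : P_{i+p}(n) → P_i` is an isomorphism for all `i ≥ 0`. -/
def HasPeriodicity (P : ChainComplex (GrMod 𝓡) ℕ) (p : ℕ) : Prop :=
  ∃ (n : ℤ) (t : ∀ i, (P.X (i + p)).shift n ≅ P.X i), ∀ i,
    (t (i + 1)).hom ≫ P.d (i + 1) i = shiftMap n (P.d (i + 1 + p) (i + p)) ≫ (t i).hom

/-- `P` is periodic of period `p`: `p` is the smallest positive integer with
`HasPeriodicity P p`. -/
def IsPeriodicOfPeriod (P : ChainComplex (GrMod 𝓡) ℕ) (p : ℕ) : Prop :=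
  IsLeast {q : ℕ | 0 < q ∧ HasPeriodicity P q} p

/-- `P` is periodic. -/
def IsPeriodic (P : ChainComplex (GrMod 𝓡) ℕ) : Prop :=
  ∃ p, IsPeriodicOfPeriod P p

end Basic

end GrMod

/-! ### Connected graded algebras and Artin–Schelter regularity -/

section Algebras

variable {k : Type v} [Field k] {A : Type u} [Ring A] [Algebra k A]

/-- A graded algebra is connected if `A₀ = k`, and locally finite if every `A_n` is
finite-dimensional. -/
structure IsConnectedLocallyFinite (𝒜 : ℕ → Submodule k A) : Prop where
  injective : Function.Injective (algebraMap k A)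
  zero_eq : (𝒜 0 : Set A) = Set.range (algebraMap k A)
  finite : ∀ n, FiniteDimensional k (𝒜 n)

/-- The (left) ideal `A₊` generated by the elements of positive degree. -/
def irrelevantIdeal (𝒜 : ℕ → Submodule k A) : Ideal A :=
  Ideal.span {a | ∃ n : ℕ, 0 < n ∧ a ∈ 𝒜 n}

/-- The left global dimension of a ring. -/
noncomputable def leftGlobalDimension (R : Type u) [Ring R] : WithBot ℕ∞ :=
  ⨆ M : ModuleCat.{u} R, projectiveDimension M

/-- Artin–Schelter regularity of dimension `d`: `gl.dim A = d`, and `Ext_A^i(k, A)` is `0` for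
`i ≠ d` and one-dimensional for `i = d`, where `k = A/A₊` is the trivial left module. No condition
on the Gelfand–Kirillov dimension is imposed. -/
structure IsASRegular (𝒜 : ℕ → Submodule k A) (d : ℕ) : Prop where
  globalDimension : leftGlobalDimension A = d
  ext_of_ne : ∀ i, i ≠ d → Subsingleton
    (Abelian.Ext (ModuleCat.of A (A ⧸ irrelevantIdeal 𝒜)) (ModuleCat.of A A) i)
  ext_self : Module.finrank k
    (Abelian.Ext (ModuleCat.of A (A ⧸ irrelevantIdeal 𝒜)) (ModuleCat.of A A) d) = 1

/-! ### The hypersurface `B = A/(f)` -/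

/-- `B = A/(f)`, the quotient by the two-sided ideal generated by `f`. -/
abbrev Hypersurface (f : A) : Type u := A ⧸ (TwoSidedIdeal.span {f}).asIdeal

/-- The projection `A → A/(f)`. -/
abbrev Hypersurface.mk (f : A) : A →+* Hypersurface f :=
  Ideal.Quotient.mk (TwoSidedIdeal.span {f}).asIdeal

/-- The grading on `A/(f)` induced by the grading on `A`. -/
def Hypersurface.grading (𝒜 : ℕ → Submodule k A) (f : A) : ℕ → AddSubgroup (Hypersurface f) :=
  fun n => (𝒜 n).toAddSubgroup.map (Hypersurface.mk f).toAddMonoidHom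

/-- The projective dimension over `A` of a graded `A/(f)`-module. -/
noncomputable def GrMod.pdOver {𝒜 : ℕ → Submodule k A} {f : A}
    (M : GrMod (Hypersurface.grading 𝒜 f)) : WithBot ℕ∞ :=
  projectiveDimension
    ((ModuleCat.restrictScalars (Hypersurface.mk f)).obj (ModuleCat.of (Hypersurface f) M.carrier))

/-! ### Normal regular elements and their normalizing automorphism -/

/-- `f` is a homogeneous normal regular element of positive degree `e`. -/
structure IsNormalRegular (𝒜 : ℕ → Submodule k A) (f : A) (e : ℕ) : Prop where
  mem : f ∈ 𝒜 e
  pos : 0 < e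
  regular : IsRegular f
  normal_left : ∀ a, ∃ b, a * f = f * b
  normal_right : ∀ b, ∃ a, a * f = f * b

namespace IsNormalRegular

variable {𝒜 : ℕ → Submodule k A} {f : A} {e : ℕ}

/-- The normalizing automorphism `σ`, determined by `a f = f σ(a)`. -/
noncomputable def sigma (h : IsNormalRegular 𝒜 f e) : A ≃ₐ[k] A :=
  AlgEquiv.ofBijective
    (AlgHom.ofLinearMap
      { toFun := fun a => (h.normal_left a).choose
        map_add' := fun a b => h.regular.left (by
          change f * _ = f * _
          rw [mul_add, ← (h.normal_left a).choose_spec, ← (h.normal_left b).choose_spec,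
            ← (h.normal_left (a + b)).choose_spec, add_mul])
        map_smul' := fun c a => h.regular.left (by
          change f * _ = f * _
          rw [← (h.normal_left (c • a)).choose_spec, RingHom.id_apply, mul_smul_comm,
            ← (h.normal_left a).choose_spec, smul_mul_assoc]) }
      (h.regular.left (by
        change f * (h.normal_left 1).choose = f * 1
        rw [← (h.normal_left 1).choose_spec, one_mul, mul_one]))
      (fun a b => h.regular.left (by
        change f * (h.normal_left (a * b)).choose =
          f * ((h.normal_left a).choose * (h.normal_left b).choose)
        rw [← (h.normal_left (a * b)).choose_spec, ← mul_assoc,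
          ← (h.normal_left a).choose_spec, mul_assoc, mul_assoc,
          ← (h.normal_left b).choose_spec])))
    (by
      constructor
      · intro a b hab
        have hab' : (h.normal_left a).choose = (h.normal_left b).choose := hab
        refine h.regular.right ?_
        change a * f = b * f
        rw [(h.normal_left a).choose_spec, (h.normal_left b).choose_spec, hab']
      · intro b
        obtain ⟨a, ha⟩ := h.normal_right b
        refine ⟨a, h.regular.left ?_⟩
        change f * (h.normal_left a).choose = f * b
        rw [← (h.normal_left a).choose_spec, ha])

theorem mul_eq (h : IsNormalRegular 𝒜 f e) (a : A) : a * f = f * h.sigma a :=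
  (h.normal_left a).choose_spec

theorem sigma_self (h : IsNormalRegular 𝒜 f e) : h.sigma f = f :=
  (h.regular.left (h.mul_eq f)).symm

theorem sigma_mem [GradedAlgebra 𝒜] (h : IsNormalRegular 𝒜 f e) {n : ℕ} {a : A}
    (ha : a ∈ 𝒜 n) : h.sigma a ∈ 𝒜 n := by
  have hfa : f * h.sigma a ∈ 𝒜 (e + n) := by
    rw [← h.mul_eq, add_comm]
    exact SetLike.mul_mem_graded ha h.mem
  have key : h.sigma a = DirectSum.decompose 𝒜 (h.sigma a) n := by
    refine h.regular.left ?_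
    change f * _ = f * _
    rw [← DirectSum.coe_decompose_mul_add_of_left_mem 𝒜 h.mem,
      DirectSum.decompose_of_mem_same 𝒜 hfa]
  rw [key]
  exact SetLike.coe_mem _

variable [GradedAlgebra 𝒜] (h : IsNormalRegular 𝒜 f e)

/-- The twisted module `M^σ`: the graded group `M` with the action `a ⬝ m = σ(a) m`. -/
noncomputable def twist (M : GrMod 𝒜) : GrMod 𝒜 where
  carrier := M.carrier
  module := Module.compHom M.carrier h.sigma.toRingEquiv.toRingHom
  grading := M.grading
  isInternal := M.isInternal
  smul_mem ha hm := M.smul_mem (h.sigma_mem ha) hm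

/-- The functor `(-)^σ` on morphisms. -/
noncomputable def twistMap {M N : GrMod 𝒜} (φ : M ⟶ N) : h.twist M ⟶ h.twist N where
  lin :=
    { toFun := φ.lin
      map_add' := φ.lin.map_add
      map_smul' := fun a x => φ.lin.map_smul (h.sigma a) x }
  map_mem hm := φ.map_mem hm

/-- `M^{tw} = M^σ(-e)`, where `e` is the degree of `f`. -/
noncomputable def tw (M : GrMod 𝒜) : GrMod 𝒜 := (h.twist M).shift (-e)

/-- The functor `(-)^{tw}` on morphisms. -/
noncomputable def twMap {M N : GrMod 𝒜} (φ : M ⟶ N) : h.tw M ⟶ h.tw N :=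
  GrMod.shiftMap (-e) (h.twistMap φ)

/-- The homomorphism `λ_f : M^{tw} → M`, left multiplication by `f`. -/
noncomputable def lam (M : GrMod 𝒜) : h.tw M ⟶ M where
  lin :=
    { toFun := fun x => (show M.carrier from f • (show M.carrier from x))
      map_add' := fun x y => smul_add f (show M.carrier from x) (show M.carrier from y)
      map_smul' := fun a x => by
        change f • (h.sigma a • (show M.carrier from x)) = a • (f • (show M.carrier from x))
        rw [smul_smul, smul_smul, h.mul_eq] }
  map_mem := by
    intro i m hm
    have hm' : (show M.carrier from m) ∈ M.grading (i + -e) := hm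
    have := M.smul_mem h.mem hm'
    rw [show (e : ℤ) + (i + -e) = i by ring] at this
    exact this

/-- The identity of `M`, as a `σ⁻¹`-semilinear map `M → M^σ`. -/
noncomputable def toTwist (M : GrMod 𝒜) :
    M.carrier →ₛₗ[(h.sigma.symm.toRingEquiv : A →+* A)] (h.twist M).carrier where
  toFun x := x
  map_add' _ _ := rfl
  map_smul' c x := by
    change c • x = h.sigma (h.sigma.symm c) • x
    rw [AlgEquiv.apply_symm_apply]

theorem isFree_tw {M : GrMod 𝒜} (hM : M.IsFree) : (h.tw M).IsFree := by
  refine GrMod.IsFree.shift ?_ _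
  obtain ⟨ι, b, hb⟩ := hM
  have : RingHomSurjective (h.sigma.symm.toRingEquiv : A →+* A) := ⟨h.sigma.symm.surjective⟩
  have hli : LinearIndependent A (h.toTwist M ∘ b) :=
    b.linearIndependent.map_of_injective_injective (h.sigma : A → A)
      (h.toTwist M : M.carrier →+ (h.twist M).carrier)
      (fun r hr => (map_eq_zero_iff _ h.sigma.injective).1 hr) (fun _ hm => hm)
      (fun r m => by
        change h.toTwist M (h.sigma r • m) = r • h.toTwist M m
        rw [map_smulₛₗ]
        exact congrArg (fun a : A => a • h.toTwist M m) (h.sigma.symm_apply_apply r))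
  have hsp : ⊤ ≤ Submodule.span A (Set.range (h.toTwist M ∘ b)) := by
    rw [Set.range_comp, ← Submodule.map_span, b.span_eq]
    rintro x -
    exact ⟨x, trivial, rfl⟩
  refine ⟨ι, Module.Basis.mk hli hsp, fun i => ?_⟩
  rw [Module.Basis.mk_apply]
  exact hb i

theorem finite_tw {M : GrMod 𝒜} (hM : Module.Finite A M.carrier) :
    Module.Finite A (h.tw M).carrier := by
  have : RingHomSurjective (h.sigma.symm.toRingEquiv : A →+* A) := ⟨h.sigma.symm.surjective⟩
  have h1 : Module.Finite A (h.twist M).carrier :=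
    Module.Finite.of_surjective (h.toTwist M) fun x => ⟨x, rfl⟩
  exact h1

/-! ### Reduction modulo `f` -/

/-- The submodule `f M`. -/
def fSub (M : GrMod 𝒜) : Submodule A M.carrier where
  carrier := {y | ∃ x : M.carrier, f • x = y}
  add_mem' := by
    rintro _ _ ⟨x, rfl⟩ ⟨y, rfl⟩
    exact ⟨x + y, smul_add _ _ _⟩
  zero_mem' := ⟨0, smul_zero _⟩
  smul_mem' := by
    rintro a _ ⟨x, rfl⟩
    exact ⟨h.sigma a • x, by rw [smul_smul, smul_smul, h.mul_eq]⟩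

set_option linter.unusedSectionVars false in
theorem isTorsionBySet (M : GrMod 𝒜) :
    Module.IsTorsionBySet A (M.carrier ⧸ h.fSub M)
      ((TwoSidedIdeal.span {f}).asIdeal : Ideal A) := by
  rintro y ⟨a, ha⟩
  have hle : TwoSidedIdeal.span {f} ≤
      TwoSidedIdeal.ker (Module.toAddMonoidEnd A (M.carrier ⧸ h.fSub M)) := by
    rw [TwoSidedIdeal.span_le]
    intro a' ha'
    rw [Set.mem_singleton_iff.1 ha', SetLike.mem_coe, TwoSidedIdeal.mem_ker]
    ext z
    obtain ⟨z, rfl⟩ := Submodule.mkQ_surjective _ z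
    change (h.fSub M).mkQ (f • z) = 0
    exact (Submodule.Quotient.mk_eq_zero _).2 ⟨z, rfl⟩
  have h0 := hle (TwoSidedIdeal.mem_asIdeal.1 ha)
  rw [TwoSidedIdeal.mem_ker] at h0
  exact DFunLike.congr_fun h0 y

/-- The reduction `M/fM` of a graded `A`-module modulo `f`, a graded module over `B = A/(f)`. -/
noncomputable def red (M : GrMod 𝒜) : GrMod (Hypersurface.grading 𝒜 f) where
  carrier := M.carrier ⧸ h.fSub M
  module := (h.isTorsionBySet M).module
  grading i := (M.grading i).map (h.fSub M).mkQ.toAddMonoidHom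
  isInternal := by
    obtain ⟨π, h0, h1, h2⟩ := exists_proj_of_isInternal M.isInternal
    have hπ : ∀ (i : ℤ) (x : M.carrier), π i (f • x) = f • π (i - e) x := by
      intro i x
      have hx : x ∈ ⨆ i, M.grading i := by
        rw [iSup_eq_top_of_isInternal M.isInternal]; trivial
      induction hx using AddSubgroup.iSup_induction' with
      | hp j x hx =>
        by_cases hij : j = i - e
        · subst hij
          rw [h1 _ _ hx]
          refine h1 _ _ ?_
          have := M.smul_mem h.mem hx
          rwa [add_sub_cancel] at this
        · rw [h2 _ _ _ hx hij, smul_zero]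
          exact h2 _ _ _ (M.smul_mem h.mem hx) (by omega)
      | h1 => simp
      | hadd x y _ _ hx hy => rw [smul_add, map_add, map_add, hx, hy, smul_add]
    refine isInternal_of_proj
      (fun i => QuotientAddGroup.map (h.fSub M).toAddSubgroup (h.fSub M).toAddSubgroup (π i) ?_)
      ?_ ?_ ?_
    · rintro _ ⟨x, rfl⟩
      exact ⟨π (i - e) x, (hπ i x).symm⟩
    · rintro i _ ⟨x, hx, rfl⟩
      exact congrArg (h.fSub M).mkQ (h1 i x hx)
    · rintro i j _ ⟨x, hx, rfl⟩ hij
      refine (congrArg (h.fSub M).mkQ (h2 i j x hx hij)).trans (map_zero _)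
    · rw [← AddSubgroup.map_iSup, iSup_eq_top_of_isInternal M.isInternal,
        ← AddMonoidHom.range_eq_map, AddMonoidHom.range_eq_top]
      exact Submodule.mkQ_surjective _
  smul_mem := by
    rintro i j _ _ ⟨a, ha, rfl⟩ ⟨m, hm, rfl⟩
    have h1 : (h.fSub M).mkQ (a • m) ∈ (M.grading (i + j)).map (h.fSub M).mkQ.toAddMonoidHom :=
      ⟨a • m, M.smul_mem ha hm, rfl⟩
    exact h1

/-- Reduction modulo `f` on morphisms. -/
noncomputable def redMap {M N : GrMod 𝒜} (φ : M ⟶ N) : h.red M ⟶ h.red N where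
  lin :=
    { toFun := (h.fSub M).mapQ (h.fSub N) φ.lin (by
        rintro _ ⟨x, rfl⟩
        exact ⟨φ.lin x, (φ.lin.map_smul f x).symm⟩)
      map_add' := fun x y => map_add _ x y
      map_smul' := by
        intro b x
        obtain ⟨a, rfl⟩ := Ideal.Quotient.mk_surjective b
        obtain ⟨x, rfl⟩ := Submodule.mkQ_surjective _ x
        change (h.fSub N).mkQ (φ.lin (a • x)) = (h.fSub N).mkQ (a • φ.lin x)
        rw [map_smul] }
  map_mem := by
    rintro i _ ⟨m, hm, rfl⟩
    exact ⟨φ.lin m, φ.map_mem hm, rfl⟩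

theorem redMap_comp_eq_zero {M N : GrMod 𝒜} (τ : h.tw M ⟶ N) (φ : N ⟶ M)
    (hτ : τ ≫ φ = h.lam M) : h.redMap τ ≫ h.redMap φ = 0 := by
  ext x
  obtain ⟨x, rfl⟩ := Submodule.mkQ_surjective _ x
  have h1 : φ.lin (τ.lin x) = f • (show M.carrier from x) :=
    DFunLike.congr_fun (congrArg GrMod.Hom.lin hτ) x
  change (h.fSub M).mkQ (φ.lin (τ.lin x)) = 0
  rw [h1]
  exact (Submodule.Quotient.mk_eq_zero _).2 ⟨_, rfl⟩

end IsNormalRegular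

/-- The algebra `A` as a graded left module over itself. -/
def GrMod.reg (𝒜 : ℕ → Submodule k A) [GradedAlgebra 𝒜] : GrMod 𝒜 where
  carrier := A
  grading i := if 0 ≤ i then (𝒜 i.toNat).toAddSubgroup else ⊥
  isInternal := by
    refine isInternal_of_proj
      (fun i => if 0 ≤ i then GradedRing.proj 𝒜 i.toNat else 0) ?_ ?_ ?_
    · intro i x hx
      by_cases hi : 0 ≤ i
      · rw [if_pos hi] at hx ⊢
        exact DirectSum.decompose_of_mem_same 𝒜 hx
      · rw [if_neg hi] at hx ⊢
        rw [AddSubgroup.mem_bot] at hx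
        rw [hx, map_zero]
    · intro i j x hx hij
      by_cases hj : 0 ≤ j
      · rw [if_pos hj] at hx
        by_cases hi : 0 ≤ i
        · rw [if_pos hi]
          exact DirectSum.decompose_of_mem_ne 𝒜 hx (by omega)
        · rw [if_neg hi]
          rfl
      · rw [if_neg hj, AddSubgroup.mem_bot] at hx
        rw [hx, map_zero]
    · classical
      rw [eq_top_iff]
      rintro x -
      rw [← DirectSum.sum_support_decompose 𝒜 x]
      refine sum_mem fun n _ => AddSubgroup.mem_iSup_of_mem (n : ℤ) ?_
      rw [if_pos (Int.natCast_nonneg n)]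
      exact SetLike.coe_mem (DirectSum.decompose 𝒜 x n)
  smul_mem := by
    intro i j a m ha hm
    by_cases hj : 0 ≤ j
    · rw [if_pos hj] at hm
      rw [if_pos (by omega), show ((i : ℤ) + j).toNat = i + j.toNat by omega]
      exact SetLike.mul_mem_graded ha hm
    · rw [if_neg hj, AddSubgroup.mem_bot] at hm
      rw [hm, smul_zero]
      exact zero_mem _

theorem GrMod.isFree_reg (𝒜 : ℕ → Submodule k A) [GradedAlgebra 𝒜] : (GrMod.reg 𝒜).IsFree := by
  refine ⟨PUnit, Module.Basis.singleton PUnit A, fun i => ⟨0, ?_⟩⟩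
  have h1 : Module.Basis.singleton PUnit A i = 1 := Module.Basis.singleton_apply ..
  have h2 : (1 : A) ∈ if (0 : ℤ) ≤ 0 then (𝒜 (0 : ℤ).toNat).toAddSubgroup else ⊥ := by
    rw [if_pos le_rfl]
    exact SetLike.one_mem_graded 𝒜
  exact h1 ▸ h2

/-! ### Twisted matrix factorizations -/

variable {𝒜 : ℕ → Submodule k A} [GradedAlgebra 𝒜] {f : A} {e : ℕ}

/-- A twisted left matrix factorization `(φ : F → G, τ : G^{tw} → F)` of `f` over `A`. -/
structure TwistedMF (h : IsNormalRegular 𝒜 f e) where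
  F : GrMod 𝒜
  G : GrMod 𝒜
  free_F : F.IsFree
  finite_F : Module.Finite A F.carrier
  free_G : G.IsFree
  finite_G : Module.Finite A G.carrier
  φ : F ⟶ G
  τ : h.tw G ⟶ F
  τ_comp_φ : τ ≫ φ = h.lam G
  φ_comp_τ : h.twMap φ ≫ τ = h.lam F

namespace TwistedMF

variable {h : IsNormalRegular 𝒜 f e}

/-- Two twisted matrix factorizations are isomorphic. -/
def Isomorphic (T T' : TwistedMF h) : Prop :=
  ∃ (α : T.G ≅ T'.G) (β : T.F ≅ T'.F), T.φ ≫ α.hom = β.hom ≫ T'.φ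

/-- The direct sum of two twisted matrix factorizations. -/
noncomputable def directSum (T T' : TwistedMF h) : TwistedMF h where
  F := T.F.prod T'.F
  G := T.G.prod T'.G
  free_F := T.free_F.prod T'.free_F
  finite_F := by
    have := T.finite_F
    have := T'.finite_F
    exact (inferInstance : Module.Finite A (T.F.carrier × T'.F.carrier))
  free_G := T.free_G.prod T'.free_G
  finite_G := by
    have := T.finite_G
    have := T'.finite_G
    exact (inferInstance : Module.Finite A (T.G.carrier × T'.G.carrier))
  φ := GrMod.prodMap T.φ T'.φ
  τ :=
    { lin :=
        { toFun := fun x => (T.τ.lin (Prod.fst x), T'.τ.lin (Prod.snd x))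
          map_add' := fun x y => Prod.ext (T.τ.lin.map_add (Prod.fst x) (Prod.fst y))
            (T'.τ.lin.map_add (Prod.snd x) (Prod.snd y))
          map_smul' := fun a x => Prod.ext (T.τ.lin.map_smul a (Prod.fst x))
            (T'.τ.lin.map_smul a (Prod.snd x)) }
      map_mem := fun hm => ⟨T.τ.map_mem hm.1, T'.τ.map_mem hm.2⟩ }
  τ_comp_φ := by
    ext x
    exact Prod.ext (DFunLike.congr_fun (congrArg GrMod.Hom.lin T.τ_comp_φ) (Prod.fst x))
      (DFunLike.congr_fun (congrArg GrMod.Hom.lin T'.τ_comp_φ) (Prod.snd x))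
  φ_comp_τ := by
    ext x
    exact Prod.ext (DFunLike.congr_fun (congrArg GrMod.Hom.lin T.φ_comp_τ) (Prod.fst x))
      (DFunLike.congr_fun (congrArg GrMod.Hom.lin T'.φ_comp_τ) (Prod.snd x))

theorem twMap_lam (M : GrMod 𝒜) : h.twMap (h.lam M) = h.lam (h.tw M) := by
  ext x
  change f • (show M.carrier from x) = h.sigma f • (show M.carrier from x)
  rw [h.sigma_self]

theorem finite_reg_shift (n : ℤ) : Module.Finite A ((GrMod.reg 𝒜).shift n).carrier :=
  (inferInstance : Module.Finite A A)

/-- The trivial factorization with `φ = λ_f : A(n)^{tw} → A(n)` (and `τ` the identity). -/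
noncomputable def trivialLeft (h : IsNormalRegular 𝒜 f e) (n : ℤ) : TwistedMF h where
  F := h.tw ((GrMod.reg 𝒜).shift n)
  G := (GrMod.reg 𝒜).shift n
  free_F := h.isFree_tw ((GrMod.isFree_reg 𝒜).shift n)
  finite_F := h.finite_tw (finite_reg_shift n)
  free_G := (GrMod.isFree_reg 𝒜).shift n
  finite_G := finite_reg_shift n
  φ := h.lam _
  τ := 𝟙 _
  τ_comp_φ := Category.id_comp _
  φ_comp_τ := by rw [Category.comp_id, twMap_lam]

/-- The trivial factorization with `τ = λ_f : A(n)^{tw} → A(n)` (and `φ` the identity). -/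
noncomputable def trivialRight (h : IsNormalRegular 𝒜 f e) (n : ℤ) : TwistedMF h where
  F := (GrMod.reg 𝒜).shift n
  G := (GrMod.reg 𝒜).shift n
  free_F := (GrMod.isFree_reg 𝒜).shift n
  finite_F := finite_reg_shift n
  free_G := (GrMod.isFree_reg 𝒜).shift n
  finite_G := finite_reg_shift n
  φ := 𝟙 _
  τ := h.lam _
  τ_comp_φ := Category.comp_id _
  φ_comp_τ := by ext x; rfl

/-- A twisted matrix factorization is reduced if it is not isomorphic to one having a trivial
direct summand. -/
def IsReduced (T : TwistedMF h) : Prop :=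
  ¬ ∃ (n : ℤ) (T' : TwistedMF h), T.Isomorphic ((trivialLeft h n).directSum T') ∨
    T.Isomorphic ((trivialRight h n).directSum T')

/-- The twisted matrix factorization `(τ, φ^{tw})` associated with `(φ, τ)`. -/
noncomputable def rotate (T : TwistedMF h) : TwistedMF h where
  F := h.tw T.G
  G := T.F
  free_F := h.isFree_tw T.free_G
  finite_F := h.finite_tw T.finite_G
  free_G := T.free_F
  finite_G := T.finite_F
  φ := T.τ
  τ := h.twMap T.φ
  τ_comp_φ := T.φ_comp_τ
  φ_comp_τ := by
    rw [← twMap_lam, ← T.τ_comp_φ]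
    rfl

/-- The sequence `(φ, τ), (τ, φ^{tw}), (φ^{tw}, τ^{tw}), (τ^{tw}, φ^{tw²}), …`. -/
noncomputable def rotateIter (T : TwistedMF h) : ℕ → TwistedMF h
  | 0 => T
  | n + 1 => (T.rotateIter n).rotate

/-- The complex `Ω(φ, τ)` of graded left `B`-modules: the reduction modulo `f` of the sequence
`⋯ → G^{tw²} → F^{tw} → G^{tw} → F → G` with differentials `…, τ^{tw}, φ^{tw}, τ, φ`, the module
`G` being placed in homological degree `0`. -/
noncomputable def Omega (T : TwistedMF h) :
    ChainComplex (GrMod (Hypersurface.grading 𝒜 f)) ℕ :=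
  ChainComplex.of (fun n => h.red (T.rotateIter n).G) (fun n => h.redMap (T.rotateIter n).φ)
    (fun n => h.redMap_comp_eq_zero _ _ (T.rotateIter n).τ_comp_φ)

theorem Omega_d (T : TwistedMF h) (n : ℕ) :
    T.Omega.d (n + 1) n = h.redMap (T.rotateIter n).φ :=
  ChainComplex.of_d (V := GrMod (Hypersurface.grading 𝒜 f))
    (X := fun n => h.red (T.rotateIter n).G) (fun n => h.redMap (T.rotateIter n).φ) n

end TwistedMF

end Algebras

/-! Write `C_i` for the cokernel of `Q_{i+1} → Q_i`, so that `C_0 = M` and `C_{i+1}` is the first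
syzygy of `C_i` over `B`. A free `B`-module has projective dimension at most 1 over `A`, because `f`
is regular and normal. Dimension shifting and `gl.dim A = d` then give `pd_A C_i ≤ 1` for all `i ≥
d`.

Suppose `pd_A C_0 ≤ 1`. Lift `Q_0` to a graded free `A`-module `G` with `G/fG = Q_0`, and let `F ⊆
G` be the preimage of the image of `Q_1`. Since `G/F = C_0`, the module `F` is projective, hence
graded free, and it contains `fG`. The inclusion `φ : F → G` and multiplication by `f`, `τ : G^{tw}
→ F`, form a factorization. The image of `φ` lies in `A₊G` because `Q` is minimal. If the image of
`τ` is not contained in `A₊F`, a unit coordinate of some `f z` yields a surjection from `C_0` onto a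
shift of `B` (`exists_surjective_of_not_minimal`). So if `C_0` has no free summand, both maps are
minimal, `Ω(φ, τ)` is a minimal acyclic complex with the same first image as `Q`, and uniqueness of
minimal covers identifies the two complexes (`IsMinimalAcyclic.exists_iso`).

Freeness from summands is automatic one step after the dimension drops: if `pd_A C_i ≤ 1`, then
`C_{i+1}` does not map onto `B` (`IsMinimalAcyclic.not_surjective`). Thus every `C_i` with `i > d`
is stable, meaning that `pd_A C_i ≤ 1` and there is no surjection onto `B`. This gives the first
assertion.

Rotating a factorization twice twists it by `σ` and shifts degrees by `e`; after `2|σ|` rotations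
only the shift remains, whence the bound on the period. Conversely, a period identifies `C_0` up to
shift with some `C_i`, `i > d`, so a periodic `Q` has stable `C_0 = M`. A nonzero module killed by
`f` is not projective over `A`, so for `M ≠ 0` its projective dimension is exactly 1.

Nakayama's lemma and minimal covers are needed over both `A` and `B`; they are proved for any ring
satisfying `IsAugmented`. -/

namespace GrMod

/-! ### Homogeneous components of graded modules -/

section Projections

variable {R : Type u} [Ring R] {S : Type*} [SetLike S R] {𝓡 : ℕ → S}

/-- The projection of a graded module onto its component of degree `i`. -/
noncomputable def proj (M : GrMod 𝓡) : ℤ → M.carrier →+ M.carrier :=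
  (exists_proj_of_isInternal M.isInternal).choose

theorem proj_mem (M : GrMod 𝓡) (i : ℤ) (x : M.carrier) : M.proj i x ∈ M.grading i :=
  (exists_proj_of_isInternal M.isInternal).choose_spec.1 i x

theorem proj_of_mem (M : GrMod 𝓡) {i : ℤ} {x : M.carrier} (hx : x ∈ M.grading i) :
    M.proj i x = x :=
  (exists_proj_of_isInternal M.isInternal).choose_spec.2.1 i x hx

theorem proj_of_mem_ne (M : GrMod 𝓡) {i j : ℤ} {x : M.carrier} (hx : x ∈ M.grading j)
    (hij : j ≠ i) : M.proj i x = 0 :=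
  (exists_proj_of_isInternal M.isInternal).choose_spec.2.2 i j x hx hij

@[elab_as_elim]
theorem homogeneous_induction (M : GrMod 𝓡) {p : M.carrier → Prop}
    (hom : ∀ i x, x ∈ M.grading i → p x) (add : ∀ x y, p x → p y → p (x + y))
    (x : M.carrier) : p x := by
  have hx : x ∈ ⨆ i, M.grading i := by
    rw [iSup_eq_top_of_isInternal M.isInternal]; trivial
  induction hx using AddSubgroup.iSup_induction' with
  | hp j x hx => exact hom j x hx
  | h1 => exact hom 0 0 (zero_mem _)
  | hadd x y _ _ hx hy => exact add x y hx hy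

theorem exists_sum_proj (M : GrMod 𝓡) (x : M.carrier) :
    ∃ s : Finset ℤ, ∀ t, s ⊆ t → ∑ i ∈ t, M.proj i x = x := by
  classical
  induction x using M.homogeneous_induction with
  | hom i x hx =>
    refine ⟨{i}, fun t ht => ?_⟩
    rw [Finset.sum_eq_single i, M.proj_of_mem hx]
    · intro j _ hj
      exact M.proj_of_mem_ne hx (Ne.symm hj)
    · intro hi
      exact absurd (ht (Finset.mem_singleton_self i)) hi
  | add x y hx hy =>
    obtain ⟨s, hs⟩ := hx
    obtain ⟨s', hs'⟩ := hy
    refine ⟨s ∪ s', fun t ht => ?_⟩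
    simp only [map_add, Finset.sum_add_distrib]
    rw [hs t (Finset.union_subset_left ht), hs' t (Finset.union_subset_right ht)]

theorem mem_of_proj_mem (M : GrMod 𝓡) {N : Type*} [SetLike N M.carrier]
    [AddSubmonoidClass N M.carrier] (n : N) {x : M.carrier}
    (h : ∀ i, M.proj i x ∈ n) : x ∈ n := by
  obtain ⟨s, hs⟩ := M.exists_sum_proj x
  rw [← hs s subset_rfl]
  exact sum_mem fun i _ => h i

theorem exists_proj_eq_zero_of_lt (M : GrMod 𝓡) (x : M.carrier) :
    ∃ n : ℤ, ∀ i < n, M.proj i x = 0 := by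
  induction x using M.homogeneous_induction with
  | hom i x hx => exact ⟨i, fun j hj => M.proj_of_mem_ne hx (by omega)⟩
  | add x y hx hy =>
    obtain ⟨a, ha⟩ := hx
    obtain ⟨b, hb⟩ := hy
    refine ⟨min a b, fun i hi => ?_⟩
    rw [map_add, ha i (by omega), hb i (by omega), add_zero]

/-- Additive maps of degree `c` between graded modules, possibly over different rings, commute with
the projections. -/
theorem proj_map_of_degree {R' : Type u} [Ring R'] {S' : Type*} [SetLike S' R'] {𝓡' : ℕ → S'}
    (M : GrMod 𝓡) (N : GrMod 𝓡') (g : M.carrier →+ N.carrier) (c : ℤ)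
    (hg : ∀ i x, x ∈ M.grading i → g x ∈ N.grading (i + c)) (i : ℤ) (x : M.carrier) :
    N.proj i (g x) = g (M.proj (i - c) x) := by
  induction x using M.homogeneous_induction with
  | hom j x hx =>
    by_cases h : j + c = i
    · subst h
      rw [N.proj_of_mem (hg j x hx), add_sub_cancel_right, M.proj_of_mem hx]
    · rw [N.proj_of_mem_ne (hg j x hx) h, M.proj_of_mem_ne hx (by omega), map_zero]
  | add x y hx hy => simp only [map_add, hx, hy]

theorem proj_lin {M N : GrMod 𝓡} (φ : M ⟶ N) (i : ℤ) (x : M.carrier) :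
    N.proj i (φ.lin x) = φ.lin (M.proj i x) := by
  have := proj_map_of_degree M N φ.lin.toAddMonoidHom 0
    (fun i x hx => by rw [add_zero]; exact φ.map_mem hx) i x
  rwa [sub_zero] at this

theorem proj_smul (M : GrMod 𝓡) {n : ℕ} {a : R} (ha : a ∈ 𝓡 n) (i : ℤ) (x : M.carrier) :
    M.proj i (a • x) = a • M.proj (i - n) x :=
  proj_map_of_degree M M (DistribSMul.toAddMonoidHom M.carrier a) n
    (fun j x hx => by rw [add_comm]; exact M.smul_mem ha hx) i x

/-- An additive map is graded if it sends additive generators into the right components. -/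
theorem mem_grading_of_closure {R' : Type u} [Ring R'] {S' : Type*} [SetLike S' R']
    {𝓡' : ℕ → S'} (M : GrMod 𝓡) (N : GrMod 𝓡') (g : M.carrier →+ N.carrier)
    {s : Set M.carrier} (hs : AddSubgroup.closure s = ⊤)
    (hg : ∀ x ∈ s, ∃ i, x ∈ M.grading i ∧ g x ∈ N.grading i) {i : ℤ} {x : M.carrier}
    (hx : x ∈ M.grading i) : g x ∈ N.grading i := by
  have key : ∀ x : M.carrier, ∀ i, N.proj i (g x) = g (M.proj i x) := by
    intro x
    have hx : x ∈ AddSubgroup.closure s := hs ▸ trivial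
    induction hx using AddSubgroup.closure_induction with
    | mem x hx =>
      obtain ⟨j, h1, h2⟩ := hg x hx
      intro i
      by_cases h : j = i
      · subst h
        rw [M.proj_of_mem h1, N.proj_of_mem h2]
      · rw [M.proj_of_mem_ne h1 h, N.proj_of_mem_ne h2 h, map_zero]
    | zero => simp
    | add x y _ _ hx hy => intro i; simp only [map_add, hx, hy]
    | neg x _ hx => intro i; simp only [map_neg, hx]
  rw [← M.proj_of_mem hx, ← key]
  exact N.proj_mem _ _

/-- A homogeneous submodule, as a graded module. -/
def sub (M : GrMod 𝓡) (N : Submodule R M.carrier) (hN : ∀ i, ∀ x ∈ N, M.proj i x ∈ N) :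
    GrMod 𝓡 where
  carrier := N
  grading i := (M.grading i).comap N.subtype.toAddMonoidHom
  isInternal := by
    refine isInternal_of_proj (fun i => ((M.proj i).comp N.subtype.toAddMonoidHom).codRestrict
      N.toAddSubgroup fun x => hN i x x.2) ?_ ?_ ?_
    · intro i x hx
      exact Subtype.ext (M.proj_of_mem hx)
    · intro i j x hx hij
      exact Subtype.ext (M.proj_of_mem_ne hx hij)
    · rw [eq_top_iff]
      rintro x -
      obtain ⟨s, hs⟩ := M.exists_sum_proj (x : M.carrier)
      have h1 : x = ∑ i ∈ s, (⟨M.proj i x, hN i x x.2⟩ : N) := by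
        refine Subtype.ext ?_
        rw [AddSubmonoidClass.coe_finsetSum]
        exact (hs s subset_rfl).symm
      rw [h1]
      exact sum_mem fun i _ => AddSubgroup.mem_iSup_of_mem i (M.proj_mem i (x : M.carrier))
  smul_mem ha hm := M.smul_mem ha hm

/-- The inclusion of a homogeneous submodule. -/
def subIncl (M : GrMod 𝓡) (N : Submodule R M.carrier) (hN : ∀ i, ∀ x ∈ N, M.proj i x ∈ N) :
    M.sub N hN ⟶ M :=
  ⟨N.subtype, fun h => h⟩

theorem proj_mem_ker {M N : GrMod 𝓡} (φ : M ⟶ N) (i : ℤ) (x : M.carrier)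
    (hx : x ∈ LinearMap.ker φ.lin) : M.proj i x ∈ LinearMap.ker φ.lin := by
  rw [LinearMap.mem_ker] at hx ⊢
  rw [← proj_lin, hx, map_zero]

theorem proj_mem_range {M N : GrMod 𝓡} (φ : M ⟶ N) (i : ℤ) (x : N.carrier)
    (hx : x ∈ LinearMap.range φ.lin) : N.proj i x ∈ LinearMap.range φ.lin := by
  obtain ⟨y, rfl⟩ := hx
  exact ⟨M.proj i y, (proj_lin φ i y).symm⟩

/-- A bijective homomorphism of graded modules is an isomorphism. -/
noncomputable def isoOfBijective {M N : GrMod 𝓡} (φ : M ⟶ N) (h : Function.Bijective φ.lin) :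
    M ≅ N where
  hom := φ
  inv := ⟨(LinearEquiv.ofBijective φ.lin h).symm, by
    intro i x hx
    have h1 : (LinearEquiv.ofBijective φ.lin h).symm x =
        M.proj i ((LinearEquiv.ofBijective φ.lin h).symm x) := by
      refine h.1 ?_
      rw [← proj_lin]
      have h2 : φ.lin ((LinearEquiv.ofBijective φ.lin h).symm x) = x :=
        (LinearEquiv.ofBijective φ.lin h).apply_symm_apply x
      rw [h2, N.proj_of_mem hx]
    change (LinearEquiv.ofBijective φ.lin h).symm x ∈ M.grading i
    rw [h1]
    exact M.proj_mem _ _⟩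
  hom_inv_id := by
    ext x
    exact (LinearEquiv.ofBijective φ.lin h).symm_apply_apply x
  inv_hom_id := by
    ext x
    exact (LinearEquiv.ofBijective φ.lin h).apply_symm_apply x

theorem hom_inv_apply {M N : GrMod 𝓡} (t : M ≅ N) (x : M.carrier) :
    t.inv.lin (t.hom.lin x) = x :=
  DFunLike.congr_fun (congrArg Hom.lin t.hom_inv_id) x

theorem inv_hom_apply {M N : GrMod 𝓡} (t : M ≅ N) (x : N.carrier) :
    t.hom.lin (t.inv.lin x) = x :=
  DFunLike.congr_fun (congrArg Hom.lin t.inv_hom_id) x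

theorem iso_bijective {M N : GrMod 𝓡} (t : M ≅ N) : Function.Bijective t.hom.lin :=
  Function.bijective_iff_has_inverse.2 ⟨t.inv.lin, hom_inv_apply t, inv_hom_apply t⟩

theorem comp_apply {M N P : GrMod 𝓡} (φ : M ⟶ N) (ψ : N ⟶ P) (x : M.carrier) :
    (φ ≫ ψ).lin x = ψ.lin (φ.lin x) := rfl

theorem IsFree.of_iso {M N : GrMod 𝓡} (t : M ≅ N) (h : M.IsFree) : N.IsFree := by
  obtain ⟨ι, b, hb⟩ := h
  refine ⟨ι, b.map (LinearEquiv.ofBijective t.hom.lin (iso_bijective t)), fun i => ?_⟩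
  obtain ⟨n, hn⟩ := hb i
  exact ⟨n, by rw [Module.Basis.map_apply]; exact t.hom.map_mem hn⟩

theorem posPart_map_le {M N : GrMod 𝓡} (g : M.carrier →ₗ[R] N.carrier) {x : M.carrier}
    (hx : x ∈ M.posPart) : g x ∈ N.posPart := by
  have : M.posPart ≤ N.posPart.comap g := by
    refine Submodule.span_le.2 ?_
    rintro _ ⟨n, hn, a, ha, x, rfl⟩
    exact Submodule.subset_span ⟨n, hn, a, ha, g x, (g.map_smul a x).symm⟩
  exact this hx

theorem smul_mem_posPart (M : GrMod 𝓡) {n : ℕ} (hn : 0 < n) {a : R} (ha : a ∈ 𝓡 n)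
    (x : M.carrier) : a • x ∈ M.posPart :=
  Submodule.subset_span ⟨n, hn, a, ha, x, rfl⟩

end Projections

/-! ### Modules over an augmented graded ring -/

/-- The ring `R` is additively generated by the components `𝓡 n`, and has an augmentation that
vanishes on the components of positive degree. -/
structure IsAugmented {R : Type u} [Ring R] {S : Type*} [SetLike S R] (𝓡 : ℕ → S) : Prop where
  closure : AddSubgroup.closure (⋃ n, (𝓡 n : Set R)) = ⊤
  augmentation : ∃ (K : Type u) (_ : Ring K) (_ : Nontrivial K) (θ : R →+* K),
    ∀ n, 0 < n → ∀ a ∈ 𝓡 n, θ a = 0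

section Augmented

variable {R : Type u} [Ring R] {S : Type*} [SetLike S R] {𝓡 : ℕ → S}

theorem IsAugmented.induction (hR : IsAugmented 𝓡) {p : R → Prop}
    (hom : ∀ n, ∀ a ∈ 𝓡 n, p a) (zero : p 0) (add : ∀ x y, p x → p y → p (x + y))
    (neg : ∀ x, p x → p (-x)) (r : R) : p r := by
  have hr : r ∈ AddSubgroup.closure (⋃ n, (𝓡 n : Set R)) := hR.closure ▸ trivial
  induction hr using AddSubgroup.closure_induction with
  | mem x hx =>
    obtain ⟨n, hn⟩ := Set.mem_iUnion.1 hx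
    exact hom n x hn
  | zero => exact zero
  | add x y _ _ hx hy => exact add x y hx hy
  | neg x _ hx => exact neg x hx

theorem IsAugmented.closure_smul_eq_top (hR : IsAugmented 𝓡) {M : Type*} [AddCommGroup M]
    [Module R M] {s : Set M} (hs : Submodule.span R s = ⊤) :
    AddSubgroup.closure {y : M | ∃ n, ∃ a ∈ 𝓡 n, ∃ x ∈ s, y = a • x} = ⊤ := by
  set C := AddSubgroup.closure {y : M | ∃ n, ∃ a ∈ 𝓡 n, ∃ x ∈ s, y = a • x} with hC
  rw [eq_top_iff]
  rintro x -
  have hx : x ∈ Submodule.span R s := hs ▸ trivial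
  have h1 : ∀ x ∈ s, ∀ r : R, r • x ∈ C := by
    intro x hx r
    induction r using hR.induction with
    | hom n a ha => exact AddSubgroup.subset_closure ⟨n, a, ha, x, hx, rfl⟩
    | zero => rw [zero_smul]; exact zero_mem _
    | add a b ha hb => rw [add_smul]; exact add_mem ha hb
    | neg a ha => rw [neg_smul]; exact neg_mem ha
  have h2 : ∀ r : R, r • x ∈ C := by
    induction hx using Submodule.span_induction with
    | mem x hx => exact h1 x hx
    | zero => intro r; rw [smul_zero]; exact zero_mem _
    | add x y _ _ hx hy => intro r; rw [smul_add]; exact add_mem (hx r) (hy r)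
    | smul a x _ hx => intro r; rw [smul_smul]; exact hx _
  have := h2 1
  rwa [one_smul] at this

/-- Finitely many generators have components in degrees bounded below, and ring elements never lower
the degree. This starts the induction on degree in Nakayama's lemma. -/
theorem exists_bound_of_finite (hR : IsAugmented 𝓡) (M : GrMod 𝓡)
    (hM : Module.Finite R M.carrier) : ∃ n : ℤ, ∀ i < n, ∀ x, M.proj i x = 0 := by
  obtain ⟨s, hs⟩ := hM.fg_top
  choose b hb using M.exists_proj_eq_zero_of_lt
  obtain ⟨n, hn⟩ : ∃ n : ℤ, ∀ x ∈ s, n ≤ b x := by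
    obtain ⟨n, hn⟩ := (s.image b).finite_toSet.bddBelow
    exact ⟨n, fun x hx => hn (Finset.mem_coe.2 (Finset.mem_image_of_mem b hx))⟩
  refine ⟨n, fun i hi x => ?_⟩
  have hx : x ∈ AddSubgroup.closure {y | ∃ n, ∃ a ∈ 𝓡 n, ∃ x ∈ (s : Set M.carrier), y = a • x} := by
    rw [hR.closure_smul_eq_top hs]; trivial
  induction hx using AddSubgroup.closure_induction with
  | mem x hx =>
    obtain ⟨m, a, ha, y, hy, rfl⟩ := hx
    rw [M.proj_smul ha, hb y _ (by have := hn y hy; omega), smul_zero]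
  | zero => exact map_zero _
  | add x y _ _ hx hy => rw [map_add, hx, hy, add_zero]
  | neg x _ hx => rw [map_neg, hx, neg_zero]

/-- The graded Nakayama lemma. -/
theorem eq_top_of_sup_posPart (hR : IsAugmented 𝓡) (M : GrMod 𝓡)
    (hM : Module.Finite R M.carrier) (N : Submodule R M.carrier)
    (hN : ∀ i, ∀ x ∈ N, M.proj i x ∈ N) (h : N ⊔ M.posPart = ⊤) : N = ⊤ := by
  obtain ⟨n, hn⟩ := exists_bound_of_finite hR M hM
  -- Induction on the degree: a component of an element of `R₊M` is an `R`-combination of components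
  -- of strictly smaller degree, which already lie in `N`.
  have key : ∀ m : ℕ, ∀ i < n + m, ∀ x, M.proj i x ∈ N := by
    intro m
    induction m with
    | zero =>
      intro i hi x
      rw [hn i (by simpa using hi)]
      exact zero_mem _
    | succ m ih =>
      have hpos : ∀ x ∈ M.posPart, ∀ i < n + (m + 1 : ℕ), M.proj i x ∈ N := by
        intro x hx
        induction hx using Submodule.span_induction with
        | mem x hx =>
          obtain ⟨l, hl, a, ha, x, rfl⟩ := hx
          intro i hi
          rw [M.proj_smul ha]
          exact N.smul_mem _ (ih _ (by omega) x)
        | zero => intro i _; rw [map_zero]; exact zero_mem _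
        | add x y _ _ hx hy => intro i hi; rw [map_add]; exact add_mem (hx i hi) (hy i hi)
        | smul r x _ hx =>
          induction r using hR.induction with
          | hom l a ha =>
            intro i hi
            rw [M.proj_smul ha]
            exact N.smul_mem _ (hx _ (by omega))
          | zero => intro i _; rw [zero_smul, map_zero]; exact zero_mem _
          | add a b ha hb =>
            intro i hi; rw [add_smul, map_add]; exact add_mem (ha i hi) (hb i hi)
          | neg a ha => intro i hi; rw [neg_smul, map_neg]; exact neg_mem (ha i hi)
      intro i hi x
      have hx : x ∈ N ⊔ M.posPart := h ▸ trivial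
      obtain ⟨y, hy, z, hz, rfl⟩ := Submodule.mem_sup.1 hx
      rw [map_add]
      exact add_mem (hN i y hy) (hpos z hz i hi)
  rw [eq_top_iff]
  rintro x -
  refine M.mem_of_proj_mem N fun i => key (i - n + 1).toNat i (by omega) x

/-- A linear map out of a free module has degree 0 as soon as it does so on a homogeneous basis,
since `R` is additively generated by homogeneous elements. -/
theorem lin_mem_grading_of_basis (hR : IsAugmented 𝓡) {M N : GrMod 𝓡} {ι : Type*}
    (b : Module.Basis ι R M.carrier) (g : M.carrier →ₗ[R] N.carrier)
    (h : ∀ i, ∃ n, b i ∈ M.grading n ∧ g (b i) ∈ N.grading n) {i : ℤ} {x : M.carrier}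
    (hx : x ∈ M.grading i) : g x ∈ N.grading i := by
  refine mem_grading_of_closure M N g.toAddMonoidHom (hR.closure_smul_eq_top b.span_eq) ?_ hx
  rintro _ ⟨n, a, ha, _, ⟨j, rfl⟩, rfl⟩
  obtain ⟨m, h1, h2⟩ := h j
  refine ⟨n + m, M.smul_mem ha h1, ?_⟩
  have : g (a • b j) ∈ N.grading (n + m) := by
    rw [map_smul]; exact N.smul_mem ha h2
  exact this

/-- Graded free modules are graded projective. -/
theorem IsFree.exists_lift (hR : IsAugmented 𝓡) {P N X : GrMod 𝓡} (hP : P.IsFree)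
    (g : P ⟶ X) (p : N ⟶ X) (h : LinearMap.range g.lin ≤ LinearMap.range p.lin) :
    ∃ s : P ⟶ N, s ≫ p = g := by
  obtain ⟨ι, b, hb⟩ := hP
  choose n hn using hb
  have h1 : ∀ i, ∃ y ∈ N.grading (n i), p.lin y = g.lin (b i) := by
    intro i
    obtain ⟨y, hy⟩ := h ⟨b i, rfl⟩
    -- The component of degree `n i` of any preimage is again a preimage, because the target element
    -- is homogeneous of that degree.
    refine ⟨N.proj (n i) y, N.proj_mem _ _, ?_⟩
    rw [← proj_lin, hy]
    exact X.proj_of_mem (g.map_mem (hn i))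
  choose y hy hpy using h1
  refine ⟨⟨b.constr ℕ y, ?_⟩, ?_⟩
  · exact lin_mem_grading_of_basis hR b _ fun i => ⟨n i, hn i, by
      rw [b.constr_basis]; exact hy i⟩
  · refine Hom.ext (b.ext fun i => ?_)
    rw [comp_lin, LinearMap.comp_apply]
    change p.lin (b.constr ℕ y (b i)) = _
    rw [b.constr_basis, hpy]

/-- The obstruction used against unit coordinates: a linear functional on `R₊M` takes values in the
kernel of the augmentation, so it never equals 1 there. The functional need not be graded. -/
theorem map_eq_zero_of_mem_posPart {M : GrMod 𝓡} (g : M.carrier →ₗ[R] R) {K : Type*}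
    [Ring K] (θ : R →+* K) (hθ : ∀ n, 0 < n → ∀ a ∈ 𝓡 n, θ a = 0) {x : M.carrier}
    (hx : x ∈ M.posPart) : θ (g x) = 0 := by
  induction hx using Submodule.span_induction with
  | mem x hx =>
    obtain ⟨l, hl, a, ha, x, rfl⟩ := hx
    rw [map_smul, smul_eq_mul, map_mul, hθ l hl a ha, zero_mul]
  | zero => simp
  | add x y _ _ hx hy => rw [map_add, map_add, hx, hy, add_zero]
  | smul r x _ hx => rw [map_smul, smul_eq_mul, map_mul, hx, mul_zero]

/-- A graded free module that minimally covers a finite module is finite. -/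
theorem finite_of_minimal (hR : IsAugmented 𝓡) {P : GrMod 𝓡} (hP : P.IsFree) {X : Type*}
    [AddCommGroup X] [Module R X] [hX : Module.Finite R X] (p : P.carrier →ₗ[R] X)
    (hp : Function.Surjective p) (hk : LinearMap.ker p ≤ P.posPart) :
    Module.Finite R P.carrier := by
  classical
  obtain ⟨ι, b, hb⟩ := hP
  obtain ⟨K, _, _, θ, hθ⟩ := hR.augmentation
  obtain ⟨s, hs⟩ := hX.fg_top
  choose q hq using hp
  -- Lift finitely many generators of `X`. A basis vector `b i` outside all their supports agrees
  -- modulo `ker p ⊆ R₊P` with some `z` whose `i`-th coordinate is 0, so `b i - z` is an element of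
  -- `R₊P` with coordinate 1.
  have hfin : ∀ i, i ∈ s.biUnion (fun x => (b.repr (q x)).support) := by
    intro i
    by_contra hi
    have h0 : ∀ x ∈ s, b.repr (q x) i = 0 := by
      intro x hx
      by_contra h
      exact hi (Finset.mem_biUnion.2 ⟨x, hx, Finsupp.mem_support_iff.2 h⟩)
    have hspan : p (b i) ∈ Submodule.span R (p '' (q '' (s : Set X))) := by
      have h1 : p '' (q '' (s : Set X)) = s := by
        rw [Set.image_image]; simp [hq]
      rw [h1, hs]; trivial
    rw [← Submodule.map_span] at hspan
    obtain ⟨z, hz, hzb⟩ := hspan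
    have hz0 : b.repr z i = 0 := by
      have : Submodule.span R (q '' (s : Set X)) ≤ LinearMap.ker (b.coord i) := by
        refine Submodule.span_le.2 ?_
        rintro _ ⟨x, hx, rfl⟩
        exact h0 x hx
      exact this hz
    have h2 : b i - z ∈ P.posPart := hk (by rw [LinearMap.mem_ker, map_sub, hzb, sub_self])
    have h3 := map_eq_zero_of_mem_posPart (b.coord i) θ hθ h2
    rw [map_sub, b.coord_apply, b.coord_apply, hz0, sub_zero, b.repr_self, Finsupp.single_eq_same,
      map_one] at h3
    exact one_ne_zero h3
  have : Finite ι := Set.finite_univ_iff.1 ((Finset.finite_toSet _).subset fun i _ => hfin i)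
  exact Module.Finite.of_basis b

/-- Two minimal covers of the same module by graded free modules are isomorphic. -/
theorem exists_iso_of_minimal [IsNoetherianRing R] (hR : IsAugmented 𝓡) {P P' X : GrMod 𝓡}
    (hP : P.IsFree) (hP' : P'.IsFree) (fP : Module.Finite R P.carrier)
    (fP' : Module.Finite R P'.carrier) (c : P ⟶ X) (c' : P' ⟶ X)
    (hr : LinearMap.range c.lin = LinearMap.range c'.lin)
    (hk : LinearMap.ker c.lin ≤ P.posPart) (hk' : LinearMap.ker c'.lin ≤ P'.posPart) :
    ∃ s : P ≅ P', s.hom ≫ c' = c := by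
  -- An endomorphism of a minimal cover that commutes with the covering map is the identity modulo
  -- `R₊P`. It is surjective by Nakayama and injective because the module is noetherian.
  have key : ∀ {P P' : GrMod 𝓡} (c : P ⟶ X) (c' : P' ⟶ X) (s : P ⟶ P') (s' : P' ⟶ P),
      Module.Finite R P.carrier → LinearMap.ker c.lin ≤ P.posPart → s ≫ c' = c → s' ≫ c = c' →
      Function.Bijective (s ≫ s').lin := by
    intro P P' c c' s s' fP hk hs hs'
    have hsurj : Function.Surjective (s ≫ s').lin := by
      rw [← LinearMap.range_eq_top]
      refine eq_top_of_sup_posPart hR P fP _ (proj_mem_range (s ≫ s')) ?_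
      rw [eq_top_iff]
      rintro x -
      refine Submodule.mem_sup.2 ⟨(s ≫ s').lin x, ⟨x, rfl⟩, x - (s ≫ s').lin x, hk ?_, by abel⟩
      have h1 : (s ≫ s') ≫ c = c := by rw [Category.assoc, hs', hs]
      have h2 : c.lin ((s ≫ s').lin x) = c.lin x := DFunLike.congr_fun (congrArg Hom.lin h1) x
      rw [LinearMap.mem_ker, map_sub, h2, sub_self]
    exact ⟨IsNoetherian.injective_of_surjective_endomorphism _ hsurj, hsurj⟩
  obtain ⟨s, hs⟩ := hP.exists_lift hR c c' hr.le
  obtain ⟨s', hs'⟩ := hP'.exists_lift hR c' c hr.ge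
  have h1 := key c c' s s' fP hk hs hs'
  have h2 := key c' c s' s fP' hk' hs' hs
  have hb : Function.Bijective s.lin :=
    ⟨Function.Injective.of_comp (f := s'.lin) (g := s.lin) h1.1,
      Function.Surjective.of_comp (f := s.lin) (g := s'.lin) h2.2⟩
  exact ⟨isoOfBijective s hb, hs⟩

/-! ### Minimal complexes -/

/-- A complex of finitely generated graded free modules that is acyclic in positive degrees and
minimal. -/
structure IsMinimalAcyclic (Q : ChainComplex (GrMod 𝓡) ℕ) : Prop where
  free : ∀ i, (Q.X i).IsFree
  finite : ∀ i, Module.Finite R (Q.X i).carrier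
  exact_succ : ∀ i, LinearMap.ker (Q.d (i + 1) i).lin = LinearMap.range (Q.d (i + 2) (i + 1)).lin
  minimal : ∀ i, LinearMap.range (Q.d (i + 1) i).lin ≤ (Q.X i).posPart

theorem IsMinimalAcyclic.truncation {Q : ChainComplex (GrMod 𝓡) ℕ} (hQ : IsMinimalAcyclic Q)
    (m : ℕ) : IsMinimalAcyclic (GrMod.truncation Q m) where
  free i := hQ.free (i + m)
  finite i := hQ.finite (i + m)
  exact_succ i := by
    have := hQ.exact_succ (i + m)
    change LinearMap.ker (Q.d (i + 1 + m) (i + m)).lin =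
      LinearMap.range (Q.d (i + 2 + m) (i + 1 + m)).lin
    rw [show i + 1 + m = i + m + 1 by omega, show i + 2 + m = i + m + 2 by omega]
    exact this
  minimal i := by
    have := hQ.minimal (i + m)
    change LinearMap.range (Q.d (i + 1 + m) (i + m)).lin ≤ (Q.X (i + m)).posPart
    rwa [show i + 1 + m = i + m + 1 by omega]

/-- Each `Q_{i+1}` minimally covers a submodule of the finite module `Q_i`, so finiteness propagates
by noetherianity. -/
theorem IsMinimalFreeResolution.isMinimalAcyclic [IsNoetherianRing R] (hR : IsAugmented 𝓡)
    {M : GrMod 𝓡} (hM : Module.Finite R M.carrier) {Q : ChainComplex (GrMod 𝓡) ℕ}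
    {ε : Q.X 0 ⟶ M} (hQ : IsMinimalFreeResolution Q ε) : IsMinimalAcyclic Q where
  free := hQ.free
  finite := by
    intro i
    induction i with
    | zero =>
      exact finite_of_minimal hR (hQ.free 0) ε.lin hQ.surjective
        (hQ.exact_zero.le.trans (hQ.minimal 0))
    | succ i ih =>
      refine finite_of_minimal hR (hQ.free (i + 1)) (Q.d (i + 1) i).lin.rangeRestrict
        (LinearMap.surjective_rangeRestrict _) ?_
      rw [LinearMap.ker_rangeRestrict]
      exact (hQ.exact_succ i).le.trans (hQ.minimal (i + 1))
  exact_succ := hQ.exact_succ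
  minimal := hQ.minimal

/-- A minimal acyclic complex is determined by the image of its first differential. At each stage
both terms are minimal covers of the same submodule, and an isomorphism over it carries kernel to
kernel, which by exactness means next image to next image. -/
theorem IsMinimalAcyclic.exists_iso [IsNoetherianRing R] (hR : IsAugmented 𝓡)
    {Q Q' : ChainComplex (GrMod 𝓡) ℕ} (hQ : IsMinimalAcyclic Q) (hQ' : IsMinimalAcyclic Q')
    (t₀ : Q.X 0 ≅ Q'.X 0) (h₀ : LinearMap.range (Q.d 1 0 ≫ t₀.hom).lin =
      LinearMap.range (Q'.d 1 0).lin) : Nonempty (Q ≅ Q') := by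
  have step : ∀ i (t : {t : Q.X i ≅ Q'.X i // LinearMap.range (Q.d (i + 1) i ≫ t.hom).lin =
      LinearMap.range (Q'.d (i + 1) i).lin}),
      ∃ t' : {t : Q.X (i + 1) ≅ Q'.X (i + 1) // LinearMap.range (Q.d (i + 2) (i + 1) ≫ t.hom).lin =
        LinearMap.range (Q'.d (i + 2) (i + 1)).lin},
        t'.1.hom ≫ Q'.d (i + 1) i = Q.d (i + 1) i ≫ t.1.hom := by
    rintro i ⟨t, ht⟩
    have hker : LinearMap.ker (Q.d (i + 1) i ≫ t.hom).lin =
        LinearMap.range (Q.d (i + 2) (i + 1)).lin := by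
      rw [comp_lin, LinearMap.ker_comp_of_ker_eq_bot _
        (LinearMap.ker_eq_bot.2 (iso_bijective t).1), hQ.exact_succ]
    obtain ⟨s, hs⟩ := exists_iso_of_minimal hR (hQ.free (i + 1)) (hQ'.free (i + 1))
      (hQ.finite _) (hQ'.finite _) (Q.d (i + 1) i ≫ t.hom) (Q'.d (i + 1) i) ht
      (hker.le.trans (hQ.minimal _)) ((hQ'.exact_succ i).le.trans (hQ'.minimal _))
    refine ⟨⟨s, ?_⟩, hs⟩
    rw [← hQ'.exact_succ, comp_lin, LinearMap.range_comp, ← hker, ← hs, comp_lin,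
      LinearMap.ker_comp]
    exact Submodule.map_comap_eq_of_surjective (iso_bijective s).2 _
  choose next hnext using step
  let seq : ∀ i, {t : Q.X i ≅ Q'.X i // LinearMap.range (Q.d (i + 1) i ≫ t.hom).lin =
      LinearMap.range (Q'.d (i + 1) i).lin} := fun i => Nat.rec ⟨t₀, h₀⟩ (fun i t => next i t) i
  refine ⟨HomologicalComplex.Hom.isoOfComponents (fun i => (seq i).1) ?_⟩
  rintro _ j rfl
  exact hnext j (seq j)

end Augmented

end GrMod

/-! ### Connected algebras, their hypersurfaces and graded free modules -/

section Algebras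

variable {k : Type v} [Field k] {A : Type u} [Ring A] [Algebra k A]

namespace IsConnectedLocallyFinite

variable {𝒜 : ℕ → Submodule k A}

theorem nontrivial (hA : IsConnectedLocallyFinite 𝒜) : Nontrivial A :=
  hA.injective.nontrivial

theorem exists_algebraMap (hA : IsConnectedLocallyFinite 𝒜) {a : A} (ha : a ∈ 𝒜 0)
    (h0 : a ≠ 0) : ∃ c : k, c ≠ 0 ∧ algebraMap k A c = a := by
  have h1 : a ∈ Set.range (algebraMap k A) := hA.zero_eq ▸ ha
  obtain ⟨c, rfl⟩ := h1
  exact ⟨c, fun hc => h0 (by rw [hc, map_zero]), rfl⟩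

theorem isAugmented [GradedAlgebra 𝒜] (hA : IsConnectedLocallyFinite 𝒜) :
    GrMod.IsAugmented 𝒜 where
  closure := by
    classical
    rw [eq_top_iff]
    rintro x -
    rw [← DirectSum.sum_support_decompose 𝒜 x]
    exact sum_mem fun n _ => AddSubgroup.subset_closure
      (Set.mem_iUnion.2 ⟨n, SetLike.coe_mem (DirectSum.decompose 𝒜 x n)⟩)
  augmentation := ⟨A, inferInstance, hA.nontrivial, GradedRing.projZeroRingHom 𝒜, by
    intro n hn a ha
    rw [GradedRing.projZeroRingHom_apply]
    exact DirectSum.decompose_of_mem_ne 𝒜 ha hn.ne'⟩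

end IsConnectedLocallyFinite

namespace IsNormalRegular

variable {𝒜 : ℕ → Submodule k A} {f : A} {e : ℕ}

theorem mem_asIdeal_iff (h : IsNormalRegular 𝒜 f e) {x : A} :
    x ∈ (TwoSidedIdeal.span {f}).asIdeal ↔ ∃ b, f * b = x := by
  constructor
  · intro hx
    -- By normality `fA` is already two-sided, so it contains the two-sided ideal generated by `f`.
    let s : Set A := {x | ∃ b, f * b = x}
    let T : TwoSidedIdeal A := TwoSidedIdeal.mk' s ⟨0, mul_zero _⟩
      (by rintro _ _ ⟨a, rfl⟩ ⟨b, rfl⟩; exact ⟨a + b, mul_add _ _ _⟩)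
      (by rintro _ ⟨a, rfl⟩; exact ⟨-a, mul_neg _ _⟩)
      (by
        rintro x _ ⟨b, rfl⟩
        exact ⟨h.sigma x * b, by rw [← mul_assoc, ← mul_assoc, h.mul_eq]⟩)
      (by rintro _ y ⟨b, rfl⟩; exact ⟨b * y, by rw [mul_assoc]⟩)
    have hle : TwoSidedIdeal.span {f} ≤ T := by
      rw [TwoSidedIdeal.span_le]
      rintro _ rfl
      exact (TwoSidedIdeal.mem_mk' s _ _ _ _ _ _).2 ⟨1, mul_one _⟩
    exact (TwoSidedIdeal.mem_mk' s _ _ _ _ _ _).1 (hle (TwoSidedIdeal.mem_asIdeal.1 hx))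
  · rintro ⟨b, rfl⟩
    exact TwoSidedIdeal.mem_asIdeal.2 (TwoSidedIdeal.mul_mem_right _ _ _
      (TwoSidedIdeal.subset_span rfl))

theorem mk_eq_zero_iff (h : IsNormalRegular 𝒜 f e) {x : A} :
    Hypersurface.mk f x = 0 ↔ ∃ b, f * b = x := by
  rw [← h.mem_asIdeal_iff]
  exact Ideal.Quotient.eq_zero_iff_mem

theorem isAugmented_grading [GradedAlgebra 𝒜] (h : IsNormalRegular 𝒜 f e)
    (hA : IsConnectedLocallyFinite 𝒜) : GrMod.IsAugmented (Hypersurface.grading 𝒜 f) where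
  closure := by
    rw [eq_top_iff]
    rintro x -
    obtain ⟨x, rfl⟩ := Ideal.Quotient.mk_surjective x
    induction x using hA.isAugmented.induction with
    | hom n a ha =>
      exact AddSubgroup.subset_closure (Set.mem_iUnion.2 ⟨n, ⟨a, ha, rfl⟩⟩)
    | zero => rw [map_zero]; exact zero_mem _
    | add x y hx hy => rw [map_add]; exact add_mem hx hy
    | neg x hx => rw [map_neg]; exact neg_mem hx
  augmentation := by
    obtain ⟨K, _, hK, θ, hθ⟩ := hA.isAugmented.augmentation
    -- The augmentation of `A` kills `f` because `e > 0`, so it descends to `B`.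
    refine ⟨K, inferInstance, hK, Ideal.Quotient.lift _ θ ?_, ?_⟩
    · intro a ha
      obtain ⟨b, rfl⟩ := h.mem_asIdeal_iff.1 ha
      rw [map_mul, hθ e h.pos f h.mem, zero_mul]
    · rintro n hn _ ⟨a, ha, rfl⟩
      exact hθ n hn a ha

theorem nontrivial_hypersurface [GradedAlgebra 𝒜] (h : IsNormalRegular 𝒜 f e)
    (hA : IsConnectedLocallyFinite 𝒜) : Nontrivial (Hypersurface f) := by
  obtain ⟨K, _, hK, θ, -⟩ := (h.isAugmented_grading hA).augmentation
  exact θ.domain_nontrivial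

end IsNormalRegular

/-! ### Graded free modules of finite rank and graded projective modules -/

namespace GrMod

section FreeModules

variable (𝒜 : ℕ → Submodule k A) [GradedAlgebra 𝒜]

/-- The component of degree `j` of the graded left module `A`. -/
def regGrading (j : ℤ) : AddSubgroup A := (reg 𝒜).grading j

theorem mem_regGrading_of_nonneg {j : ℤ} (hj : 0 ≤ j) {a : A} :
    a ∈ regGrading 𝒜 j ↔ a ∈ 𝒜 j.toNat := by
  change a ∈ (if 0 ≤ j then (𝒜 j.toNat).toAddSubgroup else ⊥) ↔ _
  rw [if_pos hj]
  rfl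

theorem mem_regGrading_natCast {n : ℕ} {a : A} : a ∈ regGrading 𝒜 n ↔ a ∈ 𝒜 n := by
  rw [mem_regGrading_of_nonneg 𝒜 (Int.natCast_nonneg n), Int.toNat_natCast]

theorem eq_zero_of_mem_regGrading_of_neg {j : ℤ} (hj : j < 0) {a : A}
    (ha : a ∈ regGrading 𝒜 j) : a = 0 := by
  change a ∈ (if 0 ≤ j then (𝒜 j.toNat).toAddSubgroup else ⊥) at ha
  rw [if_neg (not_le.2 hj)] at ha
  exact ha

variable {𝒜}

theorem smul_mem_of_mem_regGrading (M : GrMod 𝒜) {i j : ℤ} {a : A} {x : M.carrier}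
    (ha : a ∈ regGrading 𝒜 i) (hx : x ∈ M.grading j) : a • x ∈ M.grading (i + j) := by
  by_cases hi : 0 ≤ i
  · obtain ⟨n, rfl⟩ := Int.eq_ofNat_of_zero_le hi
    exact M.smul_mem ((mem_regGrading_natCast 𝒜).1 ha) hx
  · rw [eq_zero_of_mem_regGrading_of_neg 𝒜 (not_le.1 hi) ha, zero_smul]
    exact zero_mem _

variable (𝒜)

@[elab_as_elim]
theorem regGrading_induction {p : A → Prop} (hom : ∀ i x, x ∈ regGrading 𝒜 i → p x)
    (add : ∀ x y, p x → p y → p (x + y)) (x : A) : p x :=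
  (reg 𝒜).homogeneous_induction hom add x

/-- The graded free module `⨁ A(-n i)`. -/
def freeMod {ι : Type u} [Finite ι] (n : ι → ℤ) : GrMod 𝒜 where
  carrier := ι → A
  grading j :=
    { carrier := {x | ∀ i, x i ∈ regGrading 𝒜 (j - n i)}
      add_mem' := fun hx hy i => add_mem (hx i) (hy i)
      zero_mem' := fun _ => zero_mem _
      neg_mem' := fun hx i => neg_mem (hx i) }
  isInternal := by
    classical
    have := Fintype.ofFinite ι
    obtain ⟨π, -, h1, h2⟩ := exists_proj_of_isInternal (reg 𝒜).isInternal
    let ρ : ℤ → A →+ A := π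
    refine isInternal_of_proj (fun j => AddMonoidHom.mk' (fun x i => ρ (j - n i) (x i)) ?_)
      ?_ ?_ ?_
    · intro x y
      funext i
      exact map_add (ρ (j - n i)) (x i) (y i)
    · intro j x hx
      funext i
      exact h1 _ _ (hx i)
    · intro j l x hx hlj
      funext i
      exact h2 _ _ _ (hx i) (by omega)
    · rw [eq_top_iff]
      rintro x -
      rw [← Finset.univ_sum_single x]
      refine sum_mem fun i _ => ?_
      refine regGrading_induction 𝒜 (p := fun a => (Pi.single i a : ι → A) ∈ _) ?_ ?_ (x i)
      · intro j a ha
        refine AddSubgroup.mem_iSup_of_mem (j + n i) fun l => ?_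
        by_cases hl : l = i
        · subst hl
          rwa [Pi.single_eq_same, add_sub_cancel_right]
        · rw [Pi.single_eq_of_ne hl]
          exact zero_mem (regGrading 𝒜 _)
      · intro a b ha hb
        have := add_mem ha hb
        rwa [← Pi.single_add] at this
  smul_mem := by
    intro m j a x ha hx i
    rw [add_sub_assoc]
    exact (reg 𝒜).smul_mem ha (hx i)

variable {𝒜}

/-- The standard basis of `⨁ A(-n i)`. -/
noncomputable def freeModBasis {ι : Type u} [Finite ι] (n : ι → ℤ) :
    Module.Basis ι A (freeMod 𝒜 n).carrier :=
  Pi.basisFun A ι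

theorem freeModBasis_mem {ι : Type u} [Finite ι] (n : ι → ℤ) (i : ι) :
    freeModBasis (𝒜 := 𝒜) n i ∈ (freeMod 𝒜 n).grading (n i) := by
  classical
  have h1 : freeModBasis (𝒜 := 𝒜) n i = Pi.single i (1 : A) := Pi.basisFun_apply A ι i
  rw [h1]
  intro l
  by_cases hl : l = i
  · subst hl
    rw [Pi.single_eq_same, sub_self]
    exact (mem_regGrading_natCast 𝒜 (n := 0)).2 SetLike.GradedOne.one_mem
  · rw [Pi.single_eq_of_ne hl]
    exact zero_mem (regGrading 𝒜 _)

theorem freeMod_isFree {ι : Type u} [Finite ι] (n : ι → ℤ) : (freeMod 𝒜 n).IsFree :=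
  ⟨ι, freeModBasis n, fun i => ⟨n i, freeModBasis_mem n i⟩⟩

theorem freeMod_finite {ι : Type u} [Finite ι] (n : ι → ℤ) :
    Module.Finite A (freeMod 𝒜 n).carrier :=
  Module.Finite.of_basis (freeModBasis n)

/-- A finitely generated graded module has a minimal finite cover by a graded free module. -/
theorem exists_minimal_cover (hA : IsConnectedLocallyFinite 𝒜) (F : GrMod 𝒜)
    (hF : Module.Finite A F.carrier) : ∃ P : GrMod 𝒜, P.IsFree ∧ Module.Finite A P.carrier ∧
      ∃ p : P ⟶ F, Function.Surjective p.lin ∧ LinearMap.ker p.lin ≤ P.posPart := by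
  classical
  -- A homogeneous generating set of least cardinality gives the cover.
  have hex : ∃ m : ℕ, ∃ s : Finset F.carrier, s.card = m ∧ (∀ x ∈ s, ∃ n, x ∈ F.grading n) ∧
      Submodule.span A (s : Set F.carrier) = ⊤ := by
    obtain ⟨s, hs⟩ := hF.fg_top
    choose t ht using F.exists_sum_proj
    refine ⟨_, s.biUnion fun x => (t x).image fun i => F.proj i x, rfl, ?_, ?_⟩
    · intro x hx
      obtain ⟨y, -, hy⟩ := Finset.mem_biUnion.1 hx
      obtain ⟨i, -, rfl⟩ := Finset.mem_image.1 hy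
      exact ⟨i, F.proj_mem _ _⟩
    · rw [eq_top_iff, ← hs]
      refine Submodule.span_le.2 fun x hx => ?_
      rw [← ht x (t x) subset_rfl]
      refine sum_mem fun i hi => Submodule.subset_span ?_
      exact Finset.mem_coe.2 (Finset.mem_biUnion.2 ⟨x, hx, Finset.mem_image_of_mem _ hi⟩)
  obtain ⟨s, hcard, hhom, hspan⟩ := Nat.find_spec hex
  have hmin := fun m => Nat.find_min hex (m := m)
  choose! n hn using hhom
  let P := freeMod 𝒜 (fun x : s => n x)
  let g : (s → A) →ₗ[A] F.carrier := Fintype.linearCombination A fun x : s => (x : F.carrier)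
  have hg : ∀ x : s → A, g x = ∑ i, x i • (i : F.carrier) := fun x =>
    Fintype.linearCombination_apply A _ x
  let p : P ⟶ F := ⟨g, by
    intro j x hx
    have : g x ∈ F.grading j := by
      refine (hg x).symm ▸ ?_
      refine sum_mem fun i _ => ?_
      have := smul_mem_of_mem_regGrading F (hx i) (hn i i.2)
      rwa [sub_add_cancel] at this
    exact this⟩
  refine ⟨P, freeMod_isFree _, freeMod_finite _, p, ?_, ?_⟩
  · rw [← LinearMap.range_eq_top]
    change LinearMap.range g = ⊤
    rw [Fintype.range_linearCombination, Subtype.range_coe_subtype]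
    exact hspan
  · intro x hx
    refine P.mem_of_proj_mem P.posPart fun j => ?_
    have hker := proj_mem_ker p j x hx
    have hmem := P.proj_mem j x
    generalize P.proj j x = y at hker hmem
    have hsum : y = ∑ i, (y : s → A) i • (freeModBasis (𝒜 := 𝒜) (fun x : s => n x) i) :=
      ((freeModBasis (𝒜 := 𝒜) (fun x : s => n x)).sum_repr y).symm
    rw [hsum]
    refine sum_mem fun i _ => ?_
    have hyi : (y : s → A) i ∈ regGrading 𝒜 (j - n i) := hmem i
    rcases lt_trichotomy (j - n i) 0 with hlt | heq | hgt
    · rw [eq_zero_of_mem_regGrading_of_neg 𝒜 hlt hyi, zero_smul]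
      exact zero_mem _
    · by_cases h0 : (y : s → A) i = 0
      · rw [h0, zero_smul]
        exact zero_mem _
      -- A nonzero coefficient of degree 0 in a homogeneous relation is a nonzero scalar of `k`.
      -- Dividing by it expresses one generator through the others, against minimality of the
      -- cardinality.
      · exfalso
        rw [heq] at hyi
        obtain ⟨c, hc, hca⟩ := hA.exists_algebraMap ((mem_regGrading_natCast 𝒜 (n := 0)).1 hyi) h0
        refine hmin (s.erase i).card (hcard ▸ Finset.card_erase_lt_of_mem i.2)
          ⟨s.erase i, rfl, fun x hx => ⟨n x, hn x (Finset.mem_of_mem_erase hx)⟩, ?_⟩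
        rw [eq_top_iff, ← hspan]
        refine Submodule.span_le.2 fun x hx => ?_
        by_cases hxi : x = i
        · subst hxi
          have h1 : ∑ l, (y : s → A) l • (l : F.carrier) = 0 := (hg y).symm.trans hker
          rw [← Finset.add_sum_erase _ _ (Finset.mem_univ i), ← hca, add_eq_zero_iff_eq_neg] at h1
          have h2 : (i : F.carrier) = algebraMap k A c⁻¹ • algebraMap k A c • (i : F.carrier) := by
            rw [smul_smul, ← map_mul, inv_mul_cancel₀ hc, map_one, one_smul]
          rw [h1] at h2
          suffices h3 : algebraMap k A c⁻¹ • -∑ l ∈ Finset.univ.erase i, (y : s → A) l •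
              (l : F.carrier) ∈ Submodule.span A ((s.erase i : Finset F.carrier) :
                Set F.carrier) by
            rwa [← h2] at h3
          refine Submodule.smul_mem _ _ (Submodule.neg_mem _ (sum_mem fun l hl => ?_))
          refine Submodule.smul_mem _ _ (Submodule.subset_span ?_)
          rw [Finset.mem_coe, Finset.mem_erase]
          exact ⟨fun h => Finset.ne_of_mem_erase hl (Subtype.ext h), l.2⟩
        · exact Submodule.subset_span (Finset.mem_coe.2 (Finset.mem_erase.2 ⟨hxi, hx⟩))
    · obtain ⟨m, hm⟩ := Int.eq_ofNat_of_zero_le hgt.le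
      rw [hm] at hyi
      exact smul_mem_posPart _ (by omega) ((mem_regGrading_natCast 𝒜).1 hyi) _

/-- A finitely generated graded module that is projective is graded free. -/
theorem isFree_of_projective [IsNoetherianRing A] (hA : IsConnectedLocallyFinite 𝒜) (F : GrMod 𝒜)
    (hF : Module.Finite A F.carrier) (hproj : Module.Projective A F.carrier) : F.IsFree := by
  obtain ⟨P, hP, fP, p, hp, hk⟩ := exists_minimal_cover hA F hF
  obtain ⟨l, hl⟩ := Module.projective_lifting_property p.lin LinearMap.id hp
  have hl' : ∀ x, p.lin (l x) = x := fun x => DFunLike.congr_fun hl x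
  -- The splitting `l` makes `K = ker p` a direct summand of `P`. Applying the retraction `q`, which
  -- is linear but need not be graded, to `K ⊆ A₊P` gives `K = A₊K`, and Nakayama forces `K = 0`.
  let K := P.sub (LinearMap.ker p.lin) (proj_mem_ker p)
  let q : P.carrier →ₗ[A] K.carrier :=
    (LinearMap.id - l.comp p.lin).codRestrict (LinearMap.ker p.lin) fun x => by
      rw [LinearMap.mem_ker, LinearMap.sub_apply, map_sub, LinearMap.comp_apply, hl']
      exact sub_self _
  have hq : ∀ x : K.carrier, q ((LinearMap.ker p.lin).subtype x) = x := fun x => Subtype.ext (by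
    change (x : LinearMap.ker p.lin).1 - l (p.lin (x : LinearMap.ker p.lin).1) = _
    rw [LinearMap.mem_ker.1 (x : LinearMap.ker p.lin).2, map_zero, sub_zero])
  have hpos : K.posPart = ⊤ := by
    rw [eq_top_iff]
    rintro x -
    rw [← hq x]
    exact posPart_map_le q (hk (x : LinearMap.ker p.lin).2)
  have fK : Module.Finite A K.carrier :=
    Module.Finite.iff_fg.2 (IsNoetherian.noetherian (LinearMap.ker p.lin))
  have hbot : (⊥ : Submodule A K.carrier) = ⊤ := by
    refine eq_top_of_sup_posPart hA.isAugmented K fK ⊥ ?_ (by rw [hpos, sup_top_eq])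
    intro i x hx
    rw [(Submodule.mem_bot A).1 hx, map_zero]
    exact zero_mem _
  have hinj : Function.Injective p.lin := by
    rw [← LinearMap.ker_eq_bot, eq_bot_iff]
    intro x hx
    let y : K.carrier := (⟨x, hx⟩ : LinearMap.ker p.lin)
    have hy : y ∈ (⊥ : Submodule A K.carrier) := hbot ▸ trivial
    have h0 : y = 0 := (Submodule.mem_bot A).1 hy
    exact congrArg (LinearMap.ker p.lin).subtype h0
  exact hP.of_iso (isoOfBijective p ⟨hinj, hp⟩)

end FreeModules

end GrMod

end Algebras

/-! ### Reduction modulo `f` and lifting of free modules -/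

section Algebras

variable {k : Type v} [Field k] {A : Type u} [Ring A] [Algebra k A]

namespace IsNormalRegular

variable {𝒜 : ℕ → Submodule k A} {f : A} {e : ℕ}

theorem mk_self (h : IsNormalRegular 𝒜 f e) : Hypersurface.mk f f = 0 :=
  h.mk_eq_zero_iff.2 ⟨1, mul_one f⟩

theorem smul_mem_posPart (h : IsNormalRegular 𝒜 f e) (M : GrMod 𝒜) (x : M.carrier) : f • x ∈ M.posPart :=
  GrMod.smul_mem_posPart M h.pos h.mem x

/-- A projective module embeds in a free one, where left multiplication by `f` acts coordinatewise.
-/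
theorem smul_injective (h : IsNormalRegular 𝒜 f e) {M : Type*} [AddCommGroup M] [Module A M] [Module.Projective A M]
    {x y : M} (hxy : f • x = f • y) : x = y := by
  obtain ⟨s, hs⟩ := Module.projective_def.1 (inferInstance : Module.Projective A M)
  refine hs.injective (Finsupp.ext fun i => h.regular.left ?_)
  have := DFunLike.congr_fun (congrArg s hxy) i
  rwa [map_smul, map_smul, Finsupp.smul_apply, Finsupp.smul_apply] at this

theorem smul_injective_of_isFree (h : IsNormalRegular 𝒜 f e) {M : GrMod 𝒜} (hM : M.IsFree) {x y : M.carrier}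
    (hxy : f • x = f • y) : x = y := by
  obtain ⟨ι, b, -⟩ := hM
  have := Module.Projective.of_basis b
  exact h.smul_injective hxy

variable [GradedAlgebra 𝒜] (h : IsNormalRegular 𝒜 f e)

/-- The projection `M → M/fM`. -/
noncomputable def redMk (M : GrMod 𝒜) : M.carrier →+ (h.red M).carrier :=
  (h.fSub M).mkQ.toAddMonoidHom

theorem redMk_surjective (M : GrMod 𝒜) : Function.Surjective (h.redMk M) :=
  Submodule.mkQ_surjective _

theorem redMk_smul (M : GrMod 𝒜) (a : A) (x : M.carrier) :
    h.redMk M (a • x) = Hypersurface.mk f a • h.redMk M x := rfl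

theorem redMk_eq_zero_iff {M : GrMod 𝒜} {x : M.carrier} :
    h.redMk M x = 0 ↔ ∃ y : M.carrier, f • y = x :=
  Submodule.Quotient.mk_eq_zero (h.fSub M)

theorem redMk_mem {M : GrMod 𝒜} {i : ℤ} {x : M.carrier} (hx : x ∈ M.grading i) :
    h.redMk M x ∈ (h.red M).grading i :=
  ⟨x, hx, rfl⟩

theorem redMap_redMk {M N : GrMod 𝒜} (φ : M ⟶ N) (x : M.carrier) :
    (h.redMap φ).lin (h.redMk M x) = h.redMk N (φ.lin x) := rfl

theorem proj_redMk (M : GrMod 𝒜) (i : ℤ) (x : M.carrier) :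
    (h.red M).proj i (h.redMk M x) = h.redMk M (M.proj i x) := by
  have := GrMod.proj_map_of_degree M (h.red M) (h.redMk M) 0
    (fun i x hx => by rw [add_zero]; exact h.redMk_mem hx) i x
  rwa [sub_zero] at this

/-- The basis of `M/fM` induced by a basis of `M`. -/
theorem exists_redBasis {M : GrMod 𝒜} {ι : Type*} (b : Module.Basis ι A M.carrier) :
    ∃ b' : Module.Basis ι (Hypersurface f) (h.red M).carrier, ∀ i, b' i = h.redMk M (b i) := by
  classical
  have hli : LinearIndependent (Hypersurface f) fun i => h.redMk M (b i) := by
    rw [linearIndependent_iff']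
    intro s g hg i hi
    choose a ha using fun i => Ideal.Quotient.mk_surjective (g i)
    have h1 : h.redMk M (∑ i ∈ s, a i • b i) = 0 := by
      rw [map_sum, ← hg]
      refine Finset.sum_congr rfl fun j _ => ?_
      rw [redMk_smul]
      exact congrArg (· • h.redMk M (b j)) (ha j)
    obtain ⟨y, hy⟩ := h.redMk_eq_zero_iff.1 h1
    -- A combination lying in `fM` has all its coordinates in `fA`, so the coefficients vanish in
    -- `B`.
    have h2 := congrArg (fun x => b.repr x i) hy
    simp only [map_smul, map_sum, Finsupp.smul_apply, Finsupp.finsetSum_apply, b.repr_self,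
      smul_eq_mul, Finsupp.single_apply, mul_ite, mul_one, mul_zero, Finset.sum_ite_eq',
      if_pos hi] at h2
    rw [← ha i]
    exact h.mk_eq_zero_iff.2 ⟨_, h2⟩
  have hsp : ⊤ ≤ Submodule.span (Hypersurface f) (Set.range fun i => h.redMk M (b i)) := by
    rintro x -
    obtain ⟨x, rfl⟩ := h.redMk_surjective M x
    have hx : x ∈ Submodule.span A (Set.range b) := b.span_eq ▸ trivial
    induction hx using Submodule.span_induction with
    | mem x hx =>
      obtain ⟨i, rfl⟩ := hx
      exact Submodule.subset_span ⟨i, rfl⟩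
    | zero => rw [map_zero]; exact zero_mem _
    | add x y _ _ hx hy => rw [map_add]; exact add_mem hx hy
    | smul a x _ hx => rw [redMk_smul]; exact Submodule.smul_mem _ _ hx
  exact ⟨Module.Basis.mk hli hsp, fun i => Module.Basis.mk_apply hli hsp i⟩

theorem red_isFree {M : GrMod 𝒜} (hM : M.IsFree) : (h.red M).IsFree := by
  obtain ⟨ι, b, hb⟩ := hM
  obtain ⟨b', hb'⟩ := h.exists_redBasis b
  refine ⟨ι, b', fun i => ?_⟩
  obtain ⟨n, hn⟩ := hb i
  exact ⟨n, hb' i ▸ h.redMk_mem hn⟩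

theorem red_finite {M : GrMod 𝒜} (hM : Module.Finite A M.carrier) :
    Module.Finite (Hypersurface f) (h.red M).carrier := by
  have : RingHomSurjective (Hypersurface.mk f) := ⟨Ideal.Quotient.mk_surjective⟩
  let q : M.carrier →ₛₗ[Hypersurface.mk f] (h.red M).carrier :=
    { toFun := h.redMk M
      map_add' := map_add _
      map_smul' := h.redMk_smul M }
  exact Module.Finite.of_surjective q (h.redMk_surjective M)

/-- Since `e > 0`, `fM ⊆ A₊M`. Hence minimality of a map can be tested either over `A` or over `B`.
-/
theorem redMk_mem_posPart_iff {M : GrMod 𝒜} {x : M.carrier} :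
    h.redMk M x ∈ (h.red M).posPart ↔ x ∈ M.posPart := by
  constructor
  · intro hx
    have key : ∀ y ∈ (h.red M).posPart, ∃ x ∈ M.posPart, h.redMk M x = y := by
      intro y hy
      induction hy using Submodule.span_induction with
      | mem y hy =>
        obtain ⟨n, hn, _, ⟨a, ha, rfl⟩, y, rfl⟩ := hy
        obtain ⟨x, rfl⟩ := h.redMk_surjective M y
        exact ⟨a • x, GrMod.smul_mem_posPart M hn ha x, rfl⟩
      | zero => exact ⟨0, zero_mem _, map_zero _⟩
      | add y z _ _ hy hz =>
        obtain ⟨x, hx, rfl⟩ := hy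
        obtain ⟨w, hw, rfl⟩ := hz
        exact ⟨x + w, add_mem hx hw, map_add _ _ _⟩
      | smul r y _ hy =>
        obtain ⟨x, hx, rfl⟩ := hy
        obtain ⟨a, rfl⟩ := Ideal.Quotient.mk_surjective r
        exact ⟨a • x, Submodule.smul_mem _ _ hx, rfl⟩
    obtain ⟨x', hx', hxx'⟩ := key _ hx
    obtain ⟨y, hy⟩ := h.redMk_eq_zero_iff.1
      (show h.redMk M (x - x') = 0 by rw [map_sub, hxx', sub_self])
    have := add_mem (h.smul_mem_posPart M y) hx'
    rwa [hy, sub_add_cancel] at this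
  · intro hx
    induction hx using Submodule.span_induction with
    | mem x hx =>
      obtain ⟨n, hn, a, ha, x, rfl⟩ := hx
      exact GrMod.smul_mem_posPart (h.red M) hn ⟨a, ha, rfl⟩ (h.redMk M x)
    | zero => rw [map_zero]; exact zero_mem _
    | add x y _ _ hx hy => rw [map_add]; exact add_mem hx hy
    | smul a x _ hx => rw [redMk_smul]; exact Submodule.smul_mem _ _ hx

/-- A graded free `B`-module is determined by the degrees of its basis, and `⨁ A(-n i)` has a
reduction with a basis in the same degrees. -/
theorem exists_red_iso (hA : IsConnectedLocallyFinite 𝒜) {P : GrMod (Hypersurface.grading 𝒜 f)}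
    (hP : P.IsFree) (fP : Module.Finite (Hypersurface f) P.carrier) :
    ∃ G : GrMod 𝒜, G.IsFree ∧ Module.Finite A G.carrier ∧ Nonempty (P ≅ h.red G) := by
  obtain ⟨ι, b, hb⟩ := hP
  choose n hn using hb
  have := h.nontrivial_hypersurface hA
  have : Finite ι := Module.Finite.finite_basis b
  obtain ⟨b', hb'⟩ := h.exists_redBasis (GrMod.freeModBasis (𝒜 := 𝒜) n)
  refine ⟨GrMod.freeMod 𝒜 n, GrMod.freeMod_isFree n, GrMod.freeMod_finite n, ⟨?_⟩⟩
  refine GrMod.isoOfBijective ⟨(b.equiv b' (Equiv.refl ι)).toLinearMap, fun hx => ?_⟩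
    (b.equiv b' (Equiv.refl ι)).bijective
  refine GrMod.lin_mem_grading_of_basis (h.isAugmented_grading hA) b _ (fun i => ⟨n i, hn i, ?_⟩) hx
  have h1 : b.equiv b' (Equiv.refl ι) (b i) = b' i := by rw [Module.Basis.equiv_apply]; rfl
  have h2 : b' i ∈ (h.red (GrMod.freeMod 𝒜 n)).grading (n i) :=
    hb' i ▸ h.redMk_mem (GrMod.freeModBasis_mem n i)
  exact h1 ▸ h2

end IsNormalRegular

/-! ### Projective dimension over `A` -/

/-- A `B`-module, viewed as an `A`-module. -/
noncomputable abbrev overA (f : A) (X : Type u) [AddCommGroup X] [Module (Hypersurface f) X] :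
    ModuleCat.{u} A :=
  (ModuleCat.restrictScalars (Hypersurface.mk f)).obj (ModuleCat.of (Hypersurface f) X)

theorem hasProjectiveDimensionLT_of_leftGlobalDimension {d : ℕ} (hd : leftGlobalDimension A = d)
    (X : ModuleCat.{u} A) : HasProjectiveDimensionLT X (d + 1) := by
  have h1 : projectiveDimension X ≤ (d : ℕ) := by
    rw [← hd]
    exact le_iSup (fun M : ModuleCat.{u} A => projectiveDimension M) X
  exact (projectiveDimension_le_iff X d).1 h1

section

variable {f : A} {X Y Z : Type u} [AddCommGroup X] [Module (Hypersurface f) X] [AddCommGroup Y]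
  [Module (Hypersurface f) Y] [AddCommGroup Z] [Module (Hypersurface f) Z]

theorem overA_hasProjectiveDimensionLT_of_equiv (t : X ≃ₗ[Hypersurface f] Y) {n : ℕ}
    (hX : HasProjectiveDimensionLT (overA f X) n) : HasProjectiveDimensionLT (overA f Y) n :=
  hasProjectiveDimensionLT_of_iso
    ((ModuleCat.restrictScalars (Hypersurface.mk f)).mapIso t.toModuleIso) n

theorem overA_hasProjectiveDimensionLT_of_exact (i : X →ₗ[Hypersurface f] Y)
    (p : Y →ₗ[Hypersurface f] Z) (hi : Function.Injective i) (hp : Function.Surjective p)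
    (hip : Function.Exact i p) {n : ℕ} (hY : HasProjectiveDimensionLT (overA f Y) n)
    (hZ : HasProjectiveDimensionLT (overA f Z) (n + 1)) :
    HasProjectiveDimensionLT (overA f X) n := by
  let S : ShortComplex (ModuleCat.{u} A) :=
    { X₁ := overA f X
      X₂ := overA f Y
      X₃ := overA f Z
      f := (ModuleCat.restrictScalars (Hypersurface.mk f)).map (ModuleCat.ofHom i)
      g := (ModuleCat.restrictScalars (Hypersurface.mk f)).map (ModuleCat.ofHom p)
      zero := by
        rw [← Functor.map_comp, ← ModuleCat.ofHom_comp, hip.linearMap_comp_eq_zero]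
        rfl }
  have hS : S.ShortExact := ModuleCat.shortComplex_shortExact S hip hi hp
  exact hS.hasProjectiveDimensionLT_X₁ n hY hZ

/-- Dimension shifting along `0 → F → G → X → 0`. The map `g` is only additive and semilinear over
`A → B`, which is how the composite `G → G/fG → X` arises. -/
theorem projective_of_hasProjectiveDimensionLT_two {G : Type u} [AddCommGroup G] [Module A G]
    [Module.Projective A G] (g : G →+ X) (hg : ∀ (a : A) x, g (a • x) = Hypersurface.mk f a • g x)
    (hsurj : Function.Surjective g) (hX : HasProjectiveDimensionLT (overA f X) 2)
    (F : Submodule A G) (hF : ∀ x, x ∈ F ↔ g x = 0) : Module.Projective A F := by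
  let l : G →ₗ[A] overA f X :=
    { toFun := g
      map_add' := map_add g
      map_smul' := hg }
  have hFl : F = LinearMap.ker l := by
    ext x
    exact hF x
  have hS := LinearMap.shortExact_shortComplexKer (f := l) hsurj
  have h2 : HasProjectiveDimensionLT (ModuleCat.of A G) 1 := by
    have : Projective (ModuleCat.of A G) := (IsProjective.iff_projective G).1 inferInstance
    infer_instance
  have h1 : HasProjectiveDimensionLT (ModuleCat.of A (LinearMap.ker l)) 1 :=
    hS.hasProjectiveDimensionLT_X₁ 1 h2 hX
  rw [← projective_iff_hasProjectiveDimensionLT_one, ← IsProjective.iff_projective] at h1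
  exact hFl ▸ h1

end

/-- The sequence `0 → A^(ι) → A^(ι) → B^(ι) → 0` whose first map is coordinatewise right
multiplication by `f` is a projective resolution over `A`. Right multiplication is left linear and
injective, and its image is the kernel because `Af = fA`. -/
theorem IsNormalRegular.overA_hasProjectiveDimensionLT_of_basis {𝒜 : ℕ → Submodule k A} {f : A}
    {e : ℕ} (h : IsNormalRegular 𝒜 f e) {X ι : Type u} [AddCommGroup X]
    [Module (Hypersurface f) X] (b : Module.Basis ι (Hypersurface f) X) :
    HasProjectiveDimensionLT (overA f X) 2 := by
  let g : (ι →₀ A) →ₗ[A] overA f X := Finsupp.linearCombination A (fun i => (b i : overA f X))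
  have hg : ∀ x i, b.repr (g x) i = Hypersurface.mk f (x i) := by
    intro x i
    induction x using Finsupp.induction_linear with
    | zero => rw [map_zero]; exact (congrArg (fun y : ι →₀ Hypersurface f => y i)
        (map_zero b.repr)).trans (map_zero _).symm
    | add x y hx hy =>
      rw [map_add]
      refine (congrArg (fun y : ι →₀ Hypersurface f => y i) (map_add b.repr (g x) (g y))).trans ?_
      rw [Finsupp.add_apply, Finsupp.add_apply, map_add]
      exact congrArg₂ (· + ·) hx hy
    | single j a =>
      have h1 : g (Finsupp.single j a) = (Hypersurface.mk f a • b j : X) :=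
        Finsupp.linearCombination_single A a j
      have h2 : b.repr (Hypersurface.mk f a • b j : X) i =
          Hypersurface.mk f (Finsupp.single j a i) := by
        classical
        rw [map_smul, b.repr_self, Finsupp.smul_apply, smul_eq_mul, Finsupp.single_apply,
          Finsupp.single_apply]
        split_ifs <;> simp
      exact (congrArg (fun y : X => b.repr y i) h1).trans h2
  have hsurj : Function.Surjective g := by
    intro x
    choose a ha using fun i => Ideal.Quotient.mk_surjective (b.repr x i)
    classical
    refine ⟨Finsupp.onFinset (b.repr x).support (fun i => if i ∈ (b.repr x).support then a i else 0)
      (fun i hi => by by_contra h; exact hi (if_neg h)), ?_⟩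
    refine b.repr.injective (Finsupp.ext fun i => ?_)
    refine (hg _ i).trans ?_
    rw [Finsupp.onFinset_apply]
    split_ifs with hi
    · exact ha i
    · rw [map_zero, Finsupp.notMem_support_iff.1 hi]
  have hinj : Function.Injective (Finsupp.mapRange.linearMap (α := ι)
      (LinearMap.toSpanSingleton A A f)) := by
    refine Finsupp.mapRange_injective _ (map_zero _) fun x y hxy => h.regular.right ?_
    exact hxy
  have hrange : LinearMap.range (Finsupp.mapRange.linearMap (α := ι)
      (LinearMap.toSpanSingleton A A f)) = LinearMap.ker g := by
    ext x
    rw [LinearMap.mem_range, LinearMap.mem_ker]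
    constructor
    · rintro ⟨y, rfl⟩
      refine b.repr.injective (Finsupp.ext fun i => (hg _ i).trans ?_)
      refine Eq.trans ?_ (congrArg (fun y : ι →₀ Hypersurface f => y i) (map_zero b.repr)).symm
      exact h.mk_eq_zero_iff.2 ⟨h.sigma (y i), (h.mul_eq (y i)).symm⟩
    · intro hx
      have h1 : ∀ i, ∃ c, c * f = x i := by
        intro i
        have h2 : Hypersurface.mk f (x i) = 0 := by
          rw [← hg, hx]
          exact congrArg (fun y : ι →₀ Hypersurface f => y i) (map_zero b.repr)
        obtain ⟨c, hc⟩ := h.mk_eq_zero_iff.1 h2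
        obtain ⟨c', hc'⟩ := h.normal_right c
        exact ⟨c', hc'.trans hc⟩
      choose c hc using h1
      refine ⟨Finsupp.onFinset x.support c fun i hi => ?_, Finsupp.ext fun i => hc i⟩
      rw [Finsupp.mem_support_iff, ← hc i]
      intro h0
      exact hi (h.regular.right (h0.trans (zero_mul f).symm))
  have hproj : Module.Projective A (LinearMap.ker g) := by
    rw [← hrange]
    exact Module.Projective.of_equiv (LinearEquiv.ofInjective _ hinj)
  have hS := LinearMap.shortExact_shortComplexKer (f := g) hsurj
  refine hS.hasProjectiveDimensionLT_X₃ 1 ?_ ?_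
  · have : Projective (ModuleCat.of A (LinearMap.ker g)) :=
      (IsProjective.iff_projective (LinearMap.ker g)).1 hproj
    exact (inferInstance : HasProjectiveDimensionLT (ModuleCat.of A (LinearMap.ker g)) 1)
  · have : Projective (ModuleCat.of A (ι →₀ A)) :=
      (IsProjective.iff_projective (ι →₀ A)).1 inferInstance
    have : HasProjectiveDimensionLT (ModuleCat.of A (ι →₀ A)) 1 := inferInstance
    exact hasProjectiveDimensionLT_of_ge _ 1 _ (by omega)

end Algebras

/-! ### From syzygies to matrix factorizations -/

section Algebras

variable {k : Type v} [Field k] {A : Type u} [Ring A] [Algebra k A]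

theorem IsNormalRegular.mk_mul_eq_smul {f : A} (a : A) (b : Hypersurface f) :
    Hypersurface.mk f a * b = a • b := by
  obtain ⟨b, rfl⟩ := Ideal.Quotient.mk_surjective b
  rfl

variable {𝒜 : ℕ → Submodule k A} [GradedAlgebra 𝒜] {f : A} {e : ℕ}

/-- The `A`-submodule of `M` of the elements that lie in `D` modulo `f`. -/
noncomputable def IsNormalRegular.preimage (h : IsNormalRegular 𝒜 f e) (M : GrMod 𝒜)
    (D : Submodule (Hypersurface f) (h.red M).carrier) : Submodule A M.carrier where
  carrier := {x | h.redMk M x ∈ D}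
  add_mem' := by
    intro x y hx hy
    rw [Set.mem_ofPred_eq, map_add]
    exact add_mem hx hy
  zero_mem' := by
    rw [Set.mem_ofPred_eq, map_zero]
    exact zero_mem _
  smul_mem' a x hx := D.smul_mem (Hypersurface.mk f a) hx

theorem IsNormalRegular.smul_mem_preimage (h : IsNormalRegular 𝒜 f e) (M : GrMod 𝒜)
    (D : Submodule (Hypersurface f) (h.red M).carrier) (x : M.carrier) :
    f • x ∈ h.preimage M D := by
  change h.redMk M (f • x) ∈ D
  rw [h.redMk_eq_zero_iff.2 ⟨x, rfl⟩]
  exact zero_mem _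

theorem IsNormalRegular.projective_preimage (h : IsNormalRegular 𝒜 f e) {G : GrMod 𝒜}
    (hG : G.IsFree) (D : Submodule (Hypersurface f) (h.red G).carrier)
    (hpd : HasProjectiveDimensionLT (overA f ((h.red G).carrier ⧸ D)) 2) :
    Module.Projective A (h.preimage G D) := by
  obtain ⟨ι, b, -⟩ := hG
  have := Module.Projective.of_basis b
  refine projective_of_hasProjectiveDimensionLT_two (D.mkQ.toAddMonoidHom.comp (h.redMk G)) ?_ ?_
    hpd _ ?_
  · intro a x
    change D.mkQ (Hypersurface.mk f a • h.redMk G x) = _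
    rw [map_smul]
    rfl
  · exact (Submodule.mkQ_surjective D).comp (h.redMk_surjective G)
  · intro x
    exact (Submodule.Quotient.mk_eq_zero D).symm

namespace GrMod

/-- The cokernel of the differential `Q_{i+1} → Q_i`. -/
abbrev coker (Q : ChainComplex (GrMod (Hypersurface.grading 𝒜 f)) ℕ) (i : ℕ) : Type u :=
  (Q.X i).carrier ⧸ LinearMap.range (Q.d (i + 1) i).lin

variable {Q : ChainComplex (GrMod (Hypersurface.grading 𝒜 f)) ℕ}

/-- A presentation over `A` of a cokernel that has projective dimension at most `1` over `A`. -/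
theorem IsMinimalAcyclic.exists_presentation (hA : IsConnectedLocallyFinite 𝒜)
    (h : IsNormalRegular 𝒜 f e) (hQ : IsMinimalAcyclic Q) (i : ℕ)
    (hpd : HasProjectiveDimensionLT (overA f (coker Q i)) 2) :
    ∃ (G : GrMod 𝒜) (s : Q.X i ≅ h.red G), G.IsFree ∧ Module.Finite A G.carrier ∧
      Module.Projective A
        (h.preimage G (LinearMap.range (Q.d (i + 1) i ≫ s.hom).lin)) ∧
      h.preimage G (LinearMap.range (Q.d (i + 1) i ≫ s.hom).lin) ≤ G.posPart := by
  obtain ⟨G, hG, fG, ⟨s⟩⟩ := h.exists_red_iso hA (hQ.free i) (hQ.finite i)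
  refine ⟨G, s, hG, fG, h.projective_preimage hG _ ?_, ?_⟩
  · refine overA_hasProjectiveDimensionLT_of_equiv (Submodule.Quotient.equiv _ _
      (LinearEquiv.ofBijective s.hom.lin (iso_bijective s)) ?_) hpd
    rw [comp_lin, LinearMap.range_comp]
    rfl
  · rintro x ⟨y, hy⟩
    rw [← h.redMk_mem_posPart_iff, ← hy]
    exact posPart_map_le s.hom.lin (hQ.minimal i ⟨y, rfl⟩)

/-- If `Q_i / im Q_{i+1}` has projective dimension at most `1` over `A`, then the next syzygy has no
free summand. -/
theorem IsMinimalAcyclic.not_surjective (hA : IsConnectedLocallyFinite 𝒜)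
    (h : IsNormalRegular 𝒜 f e) (hQ : IsMinimalAcyclic Q) (i : ℕ)
    (hpd : HasProjectiveDimensionLT (overA f (coker Q i)) 2)
    (π : (Q.X (i + 1)).carrier →ₗ[Hypersurface f] Hypersurface f)
    (hπ : ∀ x, π ((Q.d (i + 2) (i + 1)).lin x) = 0) : ¬ Function.Surjective π := by
  intro hsurj
  obtain ⟨G, s, hG, fG, hproj, hpos⟩ := hQ.exists_presentation hA h i hpd
  set F := h.preimage G (LinearMap.range (Q.d (i + 1) i ≫ s.hom).lin) with hF
  -- By exactness `π` factors through the image of the differential, that is, through the syzygy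
  -- itself.
  have hwell : ∀ y y', (Q.d (i + 1) i ≫ s.hom).lin y = (Q.d (i + 1) i ≫ s.hom).lin y' →
      π y = π y' := by
    intro y y' hyy
    have h1 : y - y' ∈ LinearMap.ker (Q.d (i + 1) i).lin := by
      rw [LinearMap.mem_ker, map_sub, sub_eq_zero]
      exact (iso_bijective s).1 hyy
    rw [hQ.exact_succ] at h1
    obtain ⟨w, hw⟩ := h1
    have := hπ w
    rwa [hw, map_sub, sub_eq_zero] at this
  choose y hy using fun x : F => x.2
  let ρ : F →ₗ[A] Hypersurface f :=
    { toFun := fun x => π (y x)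
      map_add' := fun x x' => by
        rw [← map_add]
        refine hwell _ _ ?_
        rw [map_add, hy, hy, hy, ← map_add]
        rfl
      map_smul' := fun a x => by
        rw [RingHom.id_apply, ← IsNormalRegular.mk_mul_eq_smul, ← smul_eq_mul, ← map_smul]
        refine hwell _ _ ?_
        rw [map_smul, hy, hy]
        rfl }
  -- The functional on the syzygy, pulled back to the projective module `F`, lifts along `A → B`.
  obtain ⟨π', hπ'⟩ := Module.projective_lifting_property
    (Submodule.mkQ (TwoSidedIdeal.span {f}).asIdeal) ρ (Submodule.mkQ_surjective _)
  have hπ'' : ∀ x, Hypersurface.mk f (π' x) = π (y x) := fun x => DFunLike.congr_fun hπ' x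
  -- The lift sends `fG` into `fA`, since `f z` is zero in the syzygy. Dividing by the regular
  -- element `f` extends `π'` from `F` to all of `G`.
  have hex : ∀ z : G.carrier, ∃ b, f * b = π' ⟨f • z, h.smul_mem_preimage G _ z⟩ := by
    intro z
    refine h.mk_eq_zero_iff.1 ((hπ'' _).trans ?_)
    refine (hwell _ 0 ?_).trans (map_zero π)
    rw [hy, map_zero]
    exact h.redMk_eq_zero_iff.2 ⟨z, rfl⟩
  choose ψ hψ using hex
  have hmul : ∀ a b : A, f * a = f * b → a = b := fun a b hab => h.regular.left hab
  let g : G.carrier →ₗ[A] A :=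
    { toFun := ψ
      map_add' := fun x x' => hmul _ _ (by
        rw [mul_add, hψ, hψ, hψ, ← map_add]
        exact congrArg π' (Subtype.ext (smul_add _ _ _)))
      map_smul' := fun a x => hmul _ _ (by
        -- Moving `f` past a scalar twice, once in `G` and once in `A`, introduces `σ` on both
        -- sides, so `ψ` is linear without a twist.
        obtain ⟨b, rfl⟩ := h.sigma.surjective a
        rw [RingHom.id_apply, smul_eq_mul, ← mul_assoc, ← h.mul_eq, mul_assoc, hψ, hψ,
          ← smul_eq_mul, ← map_smul]
        refine congrArg π' (Subtype.ext ?_)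
        change f • h.sigma b • x = b • f • x
        rw [smul_smul, smul_smul, h.mul_eq]) }
  have hgF : ∀ x : F, g x = π' x := fun x => hmul _ _ (by
    refine (hψ x).trans ?_
    rw [← smul_eq_mul, ← map_smul]
    rfl)
  obtain ⟨K, _, hK, θ, hθ⟩ := hA.isAugmented.augmentation
  -- Surjectivity gives `x ∈ F` with `π' x - 1 ∈ fA`, so the augmentation of `π' x` is 1. But `π'`
  -- extends to `G` and `F ⊆ A₊G`, so that augmentation is 0.
  obtain ⟨w, hw⟩ := hsurj 1
  obtain ⟨x, hx⟩ := h.redMk_surjective G ((Q.d (i + 1) i ≫ s.hom).lin w)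
  let x' : F := ⟨x, ⟨w, hx.symm⟩⟩
  have h1 : Hypersurface.mk f (π' x' - 1) = 0 := by
    rw [map_sub, hπ'', map_one, ← hw, sub_eq_zero]
    exact hwell _ _ ((hy x').trans hx)
  obtain ⟨b, hb⟩ := h.mk_eq_zero_iff.1 h1
  have h2 := map_eq_zero_of_mem_posPart g θ hθ (hpos x'.2)
  rw [hgF] at h2
  have h3 := congrArg θ hb
  rw [map_mul, hθ e h.pos f h.mem, zero_mul, map_sub, h2, map_one, zero_sub, eq_comm,
    neg_eq_zero] at h3
  exact one_ne_zero h3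

/-- The coordinates of a homogeneous element in a homogeneous basis. -/
theorem repr_mem_regGrading (hA : IsConnectedLocallyFinite 𝒜) {F : GrMod 𝒜} {ι : Type*}
    (b : Module.Basis ι A F.carrier) {n : ι → ℤ} (hn : ∀ i, b i ∈ F.grading (n i)) (i : ι) {j : ℤ}
    {x : F.carrier} (hx : x ∈ F.grading j) : b.repr x i ∈ regGrading 𝒜 (j - n i) := by
  classical
  refine lin_mem_grading_of_basis hA.isAugmented (N := (reg 𝒜).shift (-n i)) b (b.coord i)
    (fun l => ⟨n l, hn l, ?_⟩) hx
  change b.repr (b l) i ∈ regGrading 𝒜 (n l - n i)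
  rw [b.repr_self, Finsupp.single_apply]
  split_ifs with hl
  · subst hl
    rw [sub_self]
    exact (mem_regGrading_natCast 𝒜 (n := 0)).2 SetLike.GradedOne.one_mem
  · exact zero_mem _

theorem sigma_mem_regGrading (h : IsNormalRegular 𝒜 f e) {j : ℤ} {a : A}
    (ha : a ∈ regGrading 𝒜 j) : h.sigma a ∈ regGrading 𝒜 j := by
  by_cases hj : 0 ≤ j
  · exact (mem_regGrading_of_nonneg 𝒜 hj).2 (h.sigma_mem ((mem_regGrading_of_nonneg 𝒜 hj).1 ha))
  · rw [eq_zero_of_mem_regGrading_of_neg 𝒜 (not_le.1 hj) ha, map_zero]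
    exact zero_mem _

/-- Multiplication by `f` as a map `G^{tw} → F`, when `fG ⊆ F ⊆ G`. -/
noncomputable def lamSub (h : IsNormalRegular 𝒜 f e) (G : GrMod 𝒜) (F : Submodule A G.carrier)
    (hF : ∀ i, ∀ x ∈ F, G.proj i x ∈ F) (hfG : ∀ x : G.carrier, f • x ∈ F) :
    h.tw G ⟶ G.sub F hF :=
  ⟨(h.lam G).lin.codRestrict F hfG, fun hx => (h.lam G).map_mem hx⟩

/-- If multiplication by `f`, as a map `G^{tw} → F`, is not minimal, then `G/F` admits a graded
surjection onto a shift of `B`. -/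
theorem exists_surjective_of_not_minimal (hA : IsConnectedLocallyFinite 𝒜)
    (h : IsNormalRegular 𝒜 f e) (G : GrMod 𝒜) (F : Submodule A G.carrier)
    (hF : ∀ i, ∀ x ∈ F, G.proj i x ∈ F) (hfG : ∀ x : G.carrier, f • x ∈ F)
    (hfree : (G.sub F hF).IsFree) (x : (h.tw G).carrier)
    (hx : (lamSub h G F hF hfG).lin x ∉ (G.sub F hF).posPart) :
    ∃ (n : ℤ) (g : G ⟶ (reg 𝒜).shift n), Function.Surjective g.lin ∧
      ∀ y ∈ F, ∃ b : A, f * b = g.lin y := by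
  obtain ⟨ι, c, hc⟩ := hfree
  choose m hm using hc
  obtain ⟨i, hi⟩ : ∃ i, (lamSub h G F hF hfG).lin ((h.tw G).proj i x) ∉ (G.sub F hF).posPart := by
    by_contra hcon
    push Not at hcon
    refine hx (mem_of_proj_mem _ _ fun i => ?_)
    rw [proj_lin]
    exact hcon i
  have hz := (h.tw G).proj_mem i x
  generalize (h.tw G).proj i x = z at hi hz
  have hy := (lamSub h G F hF hfG).map_mem hz
  obtain ⟨l, hl⟩ : ∃ l, c.repr ((lamSub h G F hF hfG).lin z) l • c l ∉ (G.sub F hF).posPart := by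
    by_contra hcon
    push Not at hcon
    rw [← c.linearCombination_repr ((lamSub h G F hF hfG).lin z),
      Finsupp.linearCombination_apply] at hi
    exact hi (sum_mem fun l _ => hcon l)
  have hu := repr_mem_regGrading hA c hm l hy
  have h0 : c.repr ((lamSub h G F hF hfG).lin z) l ≠ 0 := by
    intro h0
    rw [h0, zero_smul] at hl
    exact hl (zero_mem _)
  -- A nonzero homogeneous coordinate has nonnegative degree, and positive degree would put the term
  -- in `A₊F`. The coordinate is therefore a nonzero scalar.
  have hdeg : i - m l = 0 := by
    rcases lt_trichotomy (i - m l) 0 with hlt | heq | hgt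
    · exact absurd (eq_zero_of_mem_regGrading_of_neg 𝒜 hlt hu) h0
    · exact heq
    · obtain ⟨p, hp⟩ := Int.eq_ofNat_of_zero_le hgt.le
      rw [hp] at hu
      exact absurd (GrMod.smul_mem_posPart _ (by omega) ((mem_regGrading_natCast 𝒜).1 hu) _) hl
  rw [hdeg] at hu
  obtain ⟨a, ha, hau⟩ := hA.exists_algebraMap ((mem_regGrading_natCast 𝒜 (n := 0)).1 hu) h0
  let F' := G.sub F hF
  let lf : G.carrier → F'.carrier := fun y => (⟨f • y, hfG y⟩ : F)
  have lf_add : ∀ y y', lf (y + y') = lf y + lf y' := fun y y' => Subtype.ext (smul_add f y y')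
  have lf_smul : ∀ b y, lf (h.sigma b • y) = b • lf y := fun b y => Subtype.ext (by
    change f • h.sigma b • y = b • f • y
    rw [smul_smul, smul_smul, h.mul_eq])
  -- The coordinate of `f y` is linear only up to a twist, as `f σ(b) y = b f y`; applying `σ` to it
  -- restores linearity. For `y ∈ F` the coordinate of `f y` is a left multiple of `f`, so `g` sends
  -- `F` into `fA`.
  let g : G.carrier →ₗ[A] A :=
    { toFun := fun y => h.sigma (c.repr (lf y) l)
      map_add' := fun y y' => by rw [lf_add, map_add, Finsupp.add_apply, map_add]
      map_smul' := fun b y => by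
        obtain ⟨b, rfl⟩ := h.sigma.surjective b
        rw [lf_smul, map_smul, Finsupp.smul_apply, smul_eq_mul, map_mul]
        rfl }
  -- Multiplication by `f` raises degree by `e`, and taking the coordinate at a basis vector of
  -- degree `m l` lowers it by `m l`.
  refine ⟨e - m l, ⟨g, ?_⟩, ?_, ?_⟩
  · intro j y hy
    have h1 : lf y ∈ F'.grading (e + j) := G.smul_mem h.mem hy
    have h2 := sigma_mem_regGrading h (repr_mem_regGrading hA c hm l h1)
    rw [show (e : ℤ) + j - m l = j + (e - m l) by ring] at h2
    exact h2
  · intro (b : A)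
    have h1 : g z = algebraMap k A a := by
      change h.sigma (c.repr ((lamSub h G F hF hfG).lin z) l) = _
      rw [← hau, AlgEquiv.commutes]
    refine ⟨(b * algebraMap k A a⁻¹) • (show G.carrier from z), ?_⟩
    change g ((b * algebraMap k A a⁻¹) • (show G.carrier from z)) = b
    rw [map_smul, smul_eq_mul]
    refine (congrArg _ h1).trans ?_
    rw [mul_assoc, ← map_mul, inv_mul_cancel₀ ha, map_one, mul_one]
  · intro y hy
    refine ⟨h.sigma (c.repr (show F'.carrier from (⟨y, hy⟩ : F)) l), ?_⟩
    change _ = h.sigma (c.repr (lf y) l)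
    have h1 : lf y = f • (show F'.carrier from (⟨y, hy⟩ : F)) := rfl
    rw [h1, map_smul, Finsupp.smul_apply, smul_eq_mul, map_mul, h.sigma_self]

end GrMod

namespace TwistedMF

variable {h : IsNormalRegular 𝒜 f e}

/-- Both maps of the factorization have image in the radical. -/
def IsMinimal (T : TwistedMF h) : Prop :=
  (∀ x, T.φ.lin x ∈ T.G.posPart) ∧ ∀ x, T.τ.lin x ∈ T.F.posPart

end TwistedMF

namespace GrMod

variable {Q : ChainComplex (GrMod (Hypersurface.grading 𝒜 f)) ℕ}

/-- The factorization consists of the inclusion `F ⊆ G` and multiplication by `f`. Excluding graded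
surjections onto shifts of `B` suffices, since the surjection produced by a nonminimal `τ` is
graded. -/
theorem IsMinimalAcyclic.exists_twistedMF [IsNoetherianRing A] (hA : IsConnectedLocallyFinite 𝒜)
    (h : IsNormalRegular 𝒜 f e) (hQ : IsMinimalAcyclic Q)
    (hpd : HasProjectiveDimensionLT (overA f (coker Q 0)) 2)
    (hnf : ∀ (n : ℤ) (π : Q.X 0 ⟶ h.red ((reg 𝒜).shift n)), Q.d 1 0 ≫ π = 0 →
      ¬ Function.Surjective π.lin) :
    ∃ T : TwistedMF h, T.IsMinimal ∧ ∃ s : Q.X 0 ≅ h.red T.G,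
      LinearMap.range (Q.d 1 0 ≫ s.hom).lin = LinearMap.range (h.redMap T.φ).lin := by
  obtain ⟨G, s, hG, fG, hproj, hpos⟩ := hQ.exists_presentation hA h 0 hpd
  have hF : ∀ i, ∀ x ∈ h.preimage G (LinearMap.range (Q.d 1 0 ≫ s.hom).lin), G.proj i x ∈
      h.preimage G (LinearMap.range (Q.d 1 0 ≫ s.hom).lin) := by
    intro i x hx
    have h1 := proj_mem_range (Q.d 1 0 ≫ s.hom) i (h.redMk G x) hx
    rwa [h.proj_redMk] at h1
  have fF : Module.Finite A (G.sub _ hF).carrier :=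
    Module.Finite.iff_fg.2 (IsNoetherian.noetherian
      (h.preimage G (LinearMap.range (Q.d 1 0 ≫ s.hom).lin)))
  have hfree : (G.sub _ hF).IsFree := isFree_of_projective hA _ fF hproj
  have hfG := h.smul_mem_preimage G (LinearMap.range (Q.d 1 0 ≫ s.hom).lin)
  let T : TwistedMF h :=
    { F := G.sub _ hF
      G := G
      free_F := hfree
      finite_F := fF
      free_G := hG
      finite_G := fG
      φ := G.subIncl _ hF
      τ := lamSub h G _ hF hfG
      τ_comp_φ := rfl
      φ_comp_τ := by
        ext x
        exact Subtype.ext rfl }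
  refine ⟨T, ⟨fun x => ?_, fun x => ?_⟩, s, ?_⟩
  · exact hpos (x : h.preimage G (LinearMap.range (Q.d 1 0 ≫ s.hom).lin)).2
  · by_contra hx
    obtain ⟨n, g, hg, hgF⟩ := exists_surjective_of_not_minimal hA h G _ hF hfG hfree x hx
    refine hnf n (s.hom ≫ h.redMap g) ?_ ?_
    · ext y
      obtain ⟨z, hz⟩ := h.redMk_surjective G ((Q.d 1 0 ≫ s.hom).lin y)
      obtain ⟨b, hb⟩ := hgF z ⟨y, hz.symm⟩
      change (h.redMap g).lin ((Q.d 1 0 ≫ s.hom).lin y) = 0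
      rw [← hz, h.redMap_redMk]
      exact h.redMk_eq_zero_iff.2 ⟨b, hb⟩
    · have h1 : Function.Surjective (h.redMap g).lin := by
        intro b
        obtain ⟨b, rfl⟩ := h.redMk_surjective _ b
        obtain ⟨z, rfl⟩ := hg b
        exact ⟨h.redMk G z, rfl⟩
      exact h1.comp (iso_bijective s).2
  · ext y
    constructor
    · intro hy
      obtain ⟨z, rfl⟩ := h.redMk_surjective G y
      exact ⟨h.redMk T.F (show T.F.carrier from
        (⟨z, hy⟩ : h.preimage G (LinearMap.range (Q.d 1 0 ≫ s.hom).lin))), rfl⟩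
    · rintro ⟨z, rfl⟩
      obtain ⟨z, rfl⟩ := h.redMk_surjective T.F z
      exact (z : h.preimage G (LinearMap.range (Q.d 1 0 ≫ s.hom).lin)).2

end GrMod

end Algebras

/-! ### Periodicity of minimal complexes and of `Ω(φ, τ)` -/

namespace GrMod

variable {R : Type u} [Ring R] {S : Type*} [SetLike S R] {𝓡 : ℕ → S}

/-- The degree shift of a complex. -/
def shiftComplex (n : ℤ) (P : ChainComplex (GrMod 𝓡) ℕ) : ChainComplex (GrMod 𝓡) ℕ where
  X i := (P.X i).shift n
  d i j := shiftMap n (P.d i j)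
  shape i j hij := by rw [P.shape i j hij]; rfl
  d_comp_d' i j l _ _ := congrArg (shiftMap n) (P.d_comp_d i j l)

theorem IsMinimalAcyclic.shiftComplex {Q : ChainComplex (GrMod 𝓡) ℕ} (hQ : IsMinimalAcyclic Q)
    (n : ℤ) : IsMinimalAcyclic (GrMod.shiftComplex n Q) where
  free i := (hQ.free i).shift n
  finite := hQ.finite
  exact_succ := hQ.exact_succ
  minimal := hQ.minimal

/-- Truncating and shifting preserve minimal acyclicity, so by uniqueness a period need only be
exhibited at the first differential. -/
theorem IsMinimalAcyclic.hasPeriodicity [IsNoetherianRing R] (hR : IsAugmented 𝓡)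
    {Q : ChainComplex (GrMod 𝓡) ℕ} (hQ : IsMinimalAcyclic Q) (p : ℕ) (n : ℤ)
    (t₀ : (Q.X (0 + p)).shift n ≅ Q.X 0)
    (h₀ : LinearMap.range (shiftMap n (Q.d (1 + p) (0 + p)) ≫ t₀.hom).lin =
      LinearMap.range (Q.d 1 0).lin) : HasPeriodicity Q p := by
  obtain ⟨t⟩ := IsMinimalAcyclic.exists_iso hR ((hQ.truncation p).shiftComplex n) hQ t₀ h₀
  exact ⟨n, fun i => HomologicalComplex.Hom.isoApp t i, fun i => t.hom.comm (i + 1) i⟩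

/-- The degree shift on isomorphisms. -/
def shiftIso (n : ℤ) {M N : GrMod 𝓡} (t : M ≅ N) : M.shift n ≅ N.shift n where
  hom := shiftMap n t.hom
  inv := shiftMap n t.inv
  hom_inv_id := congrArg (shiftMap n) t.hom_inv_id
  inv_hom_id := congrArg (shiftMap n) t.inv_hom_id

theorem HasPeriodicity.of_iso {Q Q' : ChainComplex (GrMod 𝓡) ℕ} (s : Q ≅ Q') {p : ℕ}
    (hQ : HasPeriodicity Q p) : HasPeriodicity Q' p := by
  obtain ⟨n, t, ht⟩ := hQ
  refine ⟨n, fun i => shiftIso n (HomologicalComplex.Hom.isoApp s (i + p)).symm ≪≫ t i ≪≫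
    HomologicalComplex.Hom.isoApp s i, fun i => ?_⟩
  have h1 : s.hom.f (i + 1) ≫ Q'.d (i + 1) i = Q.d (i + 1) i ≫ s.hom.f i := s.hom.comm _ _
  have h2 : shiftMap n (s.inv.f (i + 1 + p)) ≫ shiftMap n (Q.d (i + 1 + p) (i + p)) =
      shiftMap n (Q'.d (i + 1 + p) (i + p)) ≫ shiftMap n (s.inv.f (i + p)) :=
    congrArg (shiftMap n) (s.inv.comm (i + 1 + p) (i + p))
  change (shiftMap n (s.inv.f (i + 1 + p)) ≫ (t (i + 1)).hom ≫ s.hom.f (i + 1)) ≫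
    Q'.d (i + 1) i = shiftMap n (Q'.d (i + 1 + p) (i + p)) ≫ shiftMap n (s.inv.f (i + p)) ≫
      (t i).hom ≫ s.hom.f i
  rw [Category.assoc, Category.assoc, h1, reassoc_of% (ht i), reassoc_of% h2]

end GrMod

section Algebras

variable {k : Type v} [Field k] {A : Type u} [Ring A] [Algebra k A]

variable {𝒜 : ℕ → Submodule k A} [GradedAlgebra 𝒜] {f : A} {e : ℕ}

namespace IsNormalRegular

/-- A graded automorphism commutes with the homogeneous projections, hence so does its inverse. This
is what keeps `A₊M` unchanged when the action is twisted. -/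
theorem sigma_symm_mem (h : IsNormalRegular 𝒜 f e) {n : ℕ} {a : A} (ha : a ∈ 𝒜 n) :
    h.sigma.symm a ∈ 𝒜 n := by
  classical
  have h1 : ∀ b, ∀ m, DirectSum.decompose 𝒜 (h.sigma b) m =
      h.sigma (DirectSum.decompose 𝒜 b m : A) := by
    intro b m
    conv_lhs => rw [← DirectSum.sum_support_decompose 𝒜 b, map_sum, DirectSum.decompose_sum,
      DFinsupp.finsetSum_apply, AddSubmonoidClass.coe_finsetSum]
    have h2 : ∀ l, (DirectSum.decompose 𝒜 (h.sigma (DirectSum.decompose 𝒜 b l : A)) m : A) =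
        if l = m then h.sigma (DirectSum.decompose 𝒜 b m : A) else 0 := by
      intro l
      have h3 := h.sigma_mem (SetLike.coe_mem (DirectSum.decompose 𝒜 b l))
      split_ifs with hl
      · subst hl
        exact DirectSum.decompose_of_mem_same 𝒜 h3
      · exact DirectSum.decompose_of_mem_ne 𝒜 h3 hl
    simp only [h2]
    rw [Finset.sum_ite_eq']
    split_ifs with hm
    · rfl
    · rw [DFinsupp.notMem_support_iff.1 hm]
      exact (map_zero h.sigma).symm
  have h2 : h.sigma.symm a = DirectSum.decompose 𝒜 (h.sigma.symm a) n := by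
    refine h.sigma.injective ?_
    rw [← h1, AlgEquiv.apply_symm_apply, DirectSum.decompose_of_mem_same 𝒜 ha]
  rw [h2]
  exact SetLike.coe_mem _

theorem mem_posPart_tw (h : IsNormalRegular 𝒜 f e) {M : GrMod 𝒜} {x : M.carrier}
    (hx : x ∈ M.posPart) : (show (h.tw M).carrier from x) ∈ (h.tw M).posPart := by
  induction hx using Submodule.span_induction with
  | mem x hx =>
    obtain ⟨n, hn, a, ha, x, rfl⟩ := hx
    have h1 := GrMod.smul_mem_posPart (h.tw M) hn (h.sigma_symm_mem ha) x
    have h2 : h.sigma.symm a • (show (h.tw M).carrier from x) =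
        (show (h.tw M).carrier from a • x) := by
      change h.sigma (h.sigma.symm a) • x = a • x
      rw [AlgEquiv.apply_symm_apply]
    exact h2 ▸ h1
  | zero => exact zero_mem _
  | add x y _ _ hx hy => exact add_mem hx hy
  | smul r x _ hx =>
    have h1 := Submodule.smul_mem _ (h.sigma.symm r) hx
    have h2 : h.sigma.symm r • (show (h.tw M).carrier from x) =
        (show (h.tw M).carrier from r • x) := by
      change h.sigma (h.sigma.symm r) • x = r • x
      rw [AlgEquiv.apply_symm_apply]
    exact h2 ▸ h1

end IsNormalRegular

namespace TwistedMF

variable {h : IsNormalRegular 𝒜 f e}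

theorem τ_φ (T : TwistedMF h) (x : T.F.carrier) :
    T.τ.lin (show (h.tw T.G).carrier from T.φ.lin x) = f • x :=
  DFunLike.congr_fun (congrArg GrMod.Hom.lin T.φ_comp_τ) x

theorem φ_τ (T : TwistedMF h) (x : T.G.carrier) :
    T.φ.lin (T.τ.lin (show (h.tw T.G).carrier from x)) = f • x :=
  DFunLike.congr_fun (congrArg GrMod.Hom.lin T.τ_comp_φ) x

theorem φ_injective (T : TwistedMF h) : Function.Injective T.φ.lin := by
  intro x y hxy
  refine h.smul_injective_of_isFree T.free_F ?_
  rw [← T.τ_φ, ← T.τ_φ, hxy]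

/-- If `φ x = f y = φ (τ y)`, then `x = τ y`, because `φ` is injective. Applied to all rotations,
this gives exactness of `Ω(φ, τ)`. -/
theorem ker_redMap_φ (T : TwistedMF h) :
    LinearMap.ker (h.redMap T.φ).lin = LinearMap.range (h.redMap T.τ).lin := by
  ext x
  constructor
  · intro hx
    obtain ⟨x, rfl⟩ := h.redMk_surjective T.F x
    obtain ⟨y, hy⟩ := h.redMk_eq_zero_iff.1 (show h.redMk T.G (T.φ.lin x) = 0 from hx)
    exact ⟨h.redMk (h.tw T.G) y,
      congrArg (h.redMk T.F) (T.φ_injective ((T.φ_τ y).trans hy))⟩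
  · rintro ⟨y, rfl⟩
    exact DFunLike.congr_fun
      (congrArg GrMod.Hom.lin (h.redMap_comp_eq_zero T.τ T.φ T.τ_comp_φ)) y

theorem IsMinimal.rotate {T : TwistedMF h} (hT : T.IsMinimal) : T.rotate.IsMinimal :=
  ⟨hT.2, fun x => h.mem_posPart_tw (hT.1 x)⟩

theorem IsMinimal.rotateIter {T : TwistedMF h} (hT : T.IsMinimal) :
    ∀ n, (T.rotateIter n).IsMinimal
  | 0 => hT
  | n + 1 => (IsMinimal.rotateIter hT n).rotate

theorem IsMinimal.isMinimalAcyclic {T : TwistedMF h} (hT : T.IsMinimal) :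
    GrMod.IsMinimalAcyclic T.Omega where
  free i := h.red_isFree (T.rotateIter i).free_G
  finite i := h.red_finite (T.rotateIter i).finite_G
  exact_succ i := by
    rw [Omega_d, Omega_d]
    exact (T.rotateIter i).ker_redMap_φ
  minimal i := by
    rw [Omega_d]
    rintro _ ⟨x, rfl⟩
    obtain ⟨x, rfl⟩ := h.redMk_surjective _ x
    exact h.redMk_mem_posPart_iff.2 ((hT.rotateIter i).1 x)

/-- A factorization whose maps are minimal is reduced. -/
theorem IsMinimal.isReduced (hA : IsConnectedLocallyFinite 𝒜) {T : TwistedMF h}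
    (hT : T.IsMinimal) : T.IsReduced := by
  obtain ⟨K, _, _, θ, hθ⟩ := hA.isAugmented.augmentation
  rintro ⟨n, T', ⟨α, β, hαβ⟩ | ⟨α, β, hαβ⟩⟩
  · let T₁ := (trivialLeft h n).directSum T'
    have hcomm : ∀ x, T₁.φ.lin (β.hom.lin x) = α.hom.lin (T.φ.lin x) := fun x =>
      (DFunLike.congr_fun (congrArg GrMod.Hom.lin hαβ) x).symm
    -- An isomorphism is only required to commute with `φ`; commutation with `τ` follows by
    -- cancelling the injective map `φ`.
    have hτ : ∀ x : T.G.carrier, β.hom.lin (T.τ.lin x) =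
        T₁.τ.lin (show (h.tw T₁.G).carrier from α.hom.lin x) := by
      intro x
      refine T₁.φ_injective ?_
      rw [hcomm, T.φ_τ, map_smul]
      exact (T₁.φ_τ _).symm
    -- On the trivial summand `τ` is the identity, so it hits a basis vector, which would then lie
    -- in `A₊F`.
    let w : T₁.G.carrier := ((1 : A), (0 : T'.G.carrier))
    have h1 := GrMod.posPart_map_le β.hom.lin (hT.2 (α.inv.lin w))
    rw [hτ, GrMod.inv_hom_apply] at h1
    have h2 := GrMod.posPart_map_le (M := T₁.F) (N := h.tw ((GrMod.reg 𝒜).shift n))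
      (LinearMap.fst A (h.tw ((GrMod.reg 𝒜).shift n)).carrier T'.F.carrier) h1
    -- On the twisted module the `A`-linear coordinate is `σ⁻¹`; it sends the basis vector 1 to 1.
    let g : (h.tw ((GrMod.reg 𝒜).shift n)).carrier →ₗ[A] A :=
      { toFun := fun x => h.sigma.symm (show A from x)
        map_add' := fun x y => map_add h.sigma.symm (show A from x) (show A from y)
        map_smul' := fun a x => by
          change h.sigma.symm (h.sigma a * (show A from x)) = a * h.sigma.symm (show A from x)
          rw [map_mul, AlgEquiv.symm_apply_apply] }
    have h3 := GrMod.map_eq_zero_of_mem_posPart g θ hθ h2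
    have h4 : θ (h.sigma.symm 1) = 0 := h3
    rw [map_one, map_one] at h4
    exact one_ne_zero h4
  · let T₁ := (trivialRight h n).directSum T'
    have hcomm : ∀ x, T₁.φ.lin (β.hom.lin x) = α.hom.lin (T.φ.lin x) := fun x =>
      (DFunLike.congr_fun (congrArg GrMod.Hom.lin hαβ) x).symm
    let w : T₁.F.carrier := ((1 : A), (0 : T'.F.carrier))
    have h1 := GrMod.posPart_map_le α.hom.lin (hT.1 (β.inv.lin w))
    rw [← hcomm, GrMod.inv_hom_apply] at h1
    have h2 := GrMod.posPart_map_le (M := T₁.G) (N := (GrMod.reg 𝒜).shift n)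
      (LinearMap.fst A ((GrMod.reg 𝒜).shift n).carrier T'.G.carrier) h1
    have h3 := GrMod.map_eq_zero_of_mem_posPart (M := (GrMod.reg 𝒜).shift n)
      (LinearMap.id : A →ₗ[A] A) θ hθ h2
    have h4 : θ 1 = 0 := h3
    rw [map_one] at h4
    exact one_ne_zero h4

/-! ### Periodicity of `Ω(φ, τ)` -/

/-- Rotating does not change the underlying groups and maps: both equivalences are identities, and
only the action and the grading differ. The index `0 + 2 * m` has the shape `i + p` used in
`HasPeriodicity`. -/
theorem exists_addEquiv_rotateIter (T : TwistedMF h) (m : ℕ) :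
    ∃ (u : (T.rotateIter (0 + 2 * m)).G.carrier ≃+ T.G.carrier)
      (w : (T.rotateIter (0 + 2 * m)).F.carrier ≃+ T.F.carrier),
      (∀ a x, u (a • x) = (h.sigma ^ m) a • u x) ∧
      (∀ i x, x ∈ (T.rotateIter (0 + 2 * m)).G.grading i → u x ∈ T.G.grading (i - m * e)) ∧
      ∀ x, u ((T.rotateIter (0 + 2 * m)).φ.lin x) = T.φ.lin (w x) := by
  induction m with
  | zero =>
    refine ⟨AddEquiv.refl _, AddEquiv.refl _, fun a x => rfl, fun i x hx => ?_, fun x => rfl⟩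
    rw [Nat.cast_zero, zero_mul, sub_zero]
    exact hx
  | succ m ih =>
    obtain ⟨u, w, h1, h2, h3⟩ := ih
    refine ⟨u, w, fun a x => ?_, fun i x hx => ?_, h3⟩
    · rw [pow_succ]
      exact h1 (h.sigma a) x
    · have := h2 (i + -e) x hx
      rw [show i + -(e : ℤ) - m * e = i - (m + 1 : ℕ) * e by push_cast; ring] at this
      exact this

theorem IsMinimal.hasPeriodicity [IsNoetherianRing A] (hA : IsConnectedLocallyFinite 𝒜)
    {T : TwistedMF h} (hT : T.IsMinimal) :
    GrMod.HasPeriodicity T.Omega (2 * orderOf h.sigma) := by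
  have : IsNoetherianRing (Hypersurface f) :=
    isNoetherianRing_of_surjective A _ (Hypersurface.mk f) Ideal.Quotient.mk_surjective
  obtain ⟨u, w, h1, h2, h3⟩ := T.exists_addEquiv_rotateIter (orderOf h.sigma)
  rw [pow_orderOf_eq_one] at h1
  -- With `σ^|σ| = 1` the identity of `G` is linear again, and the remaining degree discrepancy is
  -- `|σ| e`.
  let N : ℤ := orderOf h.sigma * e
  let T' := T.rotateIter (0 + 2 * orderOf h.sigma)
  let g : T'.G.shift N ⟶ T.G :=
    ⟨{ toFun := u, map_add' := map_add u, map_smul' := h1 }, by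
      intro i x hx
      have := h2 (i + N) x hx
      rw [add_sub_cancel_right] at this
      exact this⟩
  have hg : Function.Bijective (h.redMap g).lin := by
    constructor
    · rw [← LinearMap.ker_eq_bot, eq_bot_iff]
      intro x hx
      obtain ⟨x, rfl⟩ := h.redMk_surjective _ x
      obtain ⟨y, hy⟩ := h.redMk_eq_zero_iff.1 (show h.redMk T.G (u x) = 0 from hx)
      refine h.redMk_eq_zero_iff.2 ⟨u.symm y, u.injective ?_⟩
      refine (h1 f _).trans ?_
      rw [AddEquiv.apply_symm_apply]
      exact hy
    · intro y
      obtain ⟨y, rfl⟩ := h.redMk_surjective _ y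
      exact ⟨h.redMk (T'.G.shift N) (u.symm y), congrArg (h.redMk T.G) (u.apply_symm_apply y)⟩
  let g' : (h.red T'.G).shift N ⟶ h.red T.G := ⟨(h.redMap g).lin, fun hx => (h.redMap g).map_mem hx⟩
  refine hT.isMinimalAcyclic.hasPeriodicity (h.isAugmented_grading hA) _ N
    (GrMod.isoOfBijective g' hg) ?_
  rw [show 1 + 2 * orderOf h.sigma = 0 + 2 * orderOf h.sigma + 1 by omega, Omega_d, Omega_d]
  ext y
  constructor
  · rintro ⟨x, rfl⟩
    obtain ⟨x, rfl⟩ := h.redMk_surjective _ x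
    exact ⟨h.redMk T.F (w x), congrArg (h.redMk T.G) (h3 x).symm⟩
  · rintro ⟨x, rfl⟩
    obtain ⟨x, rfl⟩ := h.redMk_surjective _ x
    refine ⟨h.redMk T'.F (w.symm x), congrArg (h.redMk T.G) ((h3 _).trans ?_)⟩
    exact congrArg T.φ.lin (w.apply_symm_apply x)

end TwistedMF

end Algebras

/-! ### Free summands, projective dimension of syzygies and stability -/

namespace GrMod

section

variable {R : Type u} [Ring R] {S : Type*} [SetLike S R] {𝓡 : ℕ → S}

/-- A graded surjection onto a nonzero graded free module splits off a free summand. -/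
theorem hasFreeSummand_of_surjective (hR : IsAugmented 𝓡) {M X : GrMod 𝓡} (hX : X.IsFree)
    (hX' : Nontrivial X.carrier) (π : M ⟶ X) (hπ : Function.Surjective π.lin) :
    M.HasFreeSummand := by
  obtain ⟨s, hs⟩ := hX.exists_lift hR (𝟙 X) π (by
    rw [LinearMap.range_eq_top.2 hπ]; exact le_top)
  have hs' : ∀ x, π.lin (s.lin x) = x := fun x => DFunLike.congr_fun (congrArg Hom.lin hs) x
  let N := M.sub (LinearMap.ker π.lin) (proj_mem_ker π)
  let g : N.prod X ⟶ M :=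
    ⟨LinearMap.coprod (LinearMap.ker π.lin).subtype s.lin, fun hx =>
      add_mem hx.1 (s.map_mem hx.2)⟩
  have hg : ∀ (y : LinearMap.ker π.lin) x, g.lin (y, x) = y + s.lin x := fun y x => rfl
  refine ⟨N, X, hX, hX', ⟨(isoOfBijective g ⟨?_, ?_⟩).symm⟩⟩
  · rintro ⟨⟨y, hy⟩, x⟩ ⟨⟨y', hy'⟩, x'⟩ hxy
    have hxy' : y + s.lin x = y' + s.lin x' := hxy
    have h1 := congrArg π.lin hxy'
    rw [map_add, map_add, hs', hs', LinearMap.mem_ker.1 hy, LinearMap.mem_ker.1 hy', zero_add,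
      zero_add] at h1
    subst h1
    exact Prod.ext (Subtype.ext (add_right_cancel hxy')) rfl
  · intro m
    refine ⟨((⟨m - s.lin (π.lin m), ?_⟩ : LinearMap.ker π.lin), π.lin m), ?_⟩
    · rw [LinearMap.mem_ker, map_sub, hs', sub_self]
    · exact (hg _ _).trans (sub_add_cancel _ _)

theorem exists_surjective_of_basis {X ι : Type*} [AddCommGroup X] [Module R X]
    (b : Module.Basis ι R X) (i : ι) : Function.Surjective (b.coord i) := by
  intro r
  refine ⟨r • b i, ?_⟩
  rw [map_smul, b.coord_apply, b.repr_self, Finsupp.single_eq_same, smul_eq_mul, mul_one]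

theorem HasFreeSummand.exists_surjective {M : GrMod 𝓡} (hM : M.HasFreeSummand) :
    ∃ π : M.carrier →ₗ[R] R, Function.Surjective π := by
  obtain ⟨N, F, ⟨ι, b, -⟩, hF, ⟨t⟩⟩ := hM
  obtain ⟨i⟩ := b.index_nonempty
  have h1 : Function.Surjective (LinearMap.snd R N.carrier F.carrier) := Prod.snd_surjective
  exact ⟨(b.coord i).comp ((LinearMap.snd R N.carrier F.carrier).comp t.hom.lin),
    (exists_surjective_of_basis b i).comp (h1.comp (iso_bijective t).2)⟩

/-- Descent of a homomorphism along a surjective homomorphism. -/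
theorem exists_desc {P M X : GrMod 𝓡} (ε : P ⟶ M) (hε : Function.Surjective ε.lin) (π : P ⟶ X)
    (h : LinearMap.ker ε.lin ≤ LinearMap.ker π.lin) : ∃ g : M ⟶ X, ε ≫ g = π := by
  let l : M.carrier →ₗ[R] X.carrier := ((LinearMap.ker ε.lin).liftQ π.lin h).comp
    (ε.lin.quotKerEquivOfSurjective hε).symm.toLinearMap
  have hl : ∀ x, l (ε.lin x) = π.lin x := by
    intro x
    have h1 : (ε.lin.quotKerEquivOfSurjective hε).symm (ε.lin x) =
        (LinearMap.ker ε.lin).mkQ x := by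
      rw [LinearEquiv.symm_apply_eq]
      rfl
    change (LinearMap.ker ε.lin).liftQ π.lin h
      ((ε.lin.quotKerEquivOfSurjective hε).symm (ε.lin x)) = _
    rw [h1]
    exact Submodule.liftQ_apply _ _ _
  refine ⟨⟨l, ?_⟩, Hom.ext (LinearMap.ext hl)⟩
  intro i m hm
  obtain ⟨x, rfl⟩ := hε m
  rw [← M.proj_of_mem hm, proj_lin, hl]
  exact π.map_mem (P.proj_mem i x)

end

section

variable {k : Type v} [Field k] {A : Type u} [Ring A] [Algebra k A]

variable {𝒜 : ℕ → Submodule k A} {f : A} {e : ℕ}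
  {Q : ChainComplex (GrMod (Hypersurface.grading 𝒜 f)) ℕ}

/-- The projective dimensions over `A` of the syzygies. -/
theorem IsMinimalAcyclic.hasProjectiveDimensionLT_coker (h : IsNormalRegular 𝒜 f e)
    (hQ : IsMinimalAcyclic Q) {d : ℕ} (hd : leftGlobalDimension A = d) (i : ℕ) :
    HasProjectiveDimensionLT (overA f (coker Q i)) (max 2 (d + 1 - i)) := by
  induction i with
  | zero =>
    have := hasProjectiveDimensionLT_of_leftGlobalDimension hd (overA f (coker Q 0))
    exact hasProjectiveDimensionLT_of_ge _ (d + 1) _ (by omega)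
  | succ i ih =>
    obtain ⟨ι, b, -⟩ := hQ.free i
    -- In `0 → C_{i+1} → Q_i → C_i → 0` the middle term has projective dimension at most 1, so the
    -- bound drops by one at each step until it reaches 1, which is recorded as `< 2`.
    have h1 := h.overA_hasProjectiveDimensionLT_of_basis b
    refine overA_hasProjectiveDimensionLT_of_exact
      ((LinearMap.range (Q.d (i + 2) (i + 1)).lin).liftQ (Q.d (i + 1) i).lin
        (hQ.exact_succ i).ge) (LinearMap.range (Q.d (i + 1) i).lin).mkQ ?_
      (Submodule.mkQ_surjective _) ?_ (hasProjectiveDimensionLT_of_ge _ 2 _ (by omega))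
      (hasProjectiveDimensionLT_of_ge _ _ _ (by omega : max 2 (d + 1 - i) ≤ _))
    · rw [← LinearMap.ker_eq_bot]
      exact Submodule.ker_liftQ_eq_bot _ _ _ (hQ.exact_succ i).le
    · rw [LinearMap.exact_iff, Submodule.ker_mkQ, Submodule.range_liftQ]

/-- The cokernel of `Q_{i+1} → Q_i` has projective dimension at most `1` over `A` and no free
summand. -/
def IsStableAt (Q : ChainComplex (GrMod (Hypersurface.grading 𝒜 f)) ℕ) (i : ℕ) : Prop :=
  HasProjectiveDimensionLT (overA f (coker Q i)) 2 ∧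
    ∀ π : (Q.X i).carrier →ₗ[Hypersurface f] Hypersurface f,
      (∀ x, π ((Q.d (i + 1) i).lin x) = 0) → ¬ Function.Surjective π

theorem IsStableAt.truncation {m : ℕ} (hQ : IsStableAt Q (0 + m)) :
    IsStableAt (GrMod.truncation Q m) 0 := by
  unfold IsStableAt coker at hQ
  rw [show 0 + m + 1 = 1 + m by omega] at hQ
  exact hQ

/-- The periodicity isomorphisms identify the two cokernels up to a degree shift. Stability refers
to ungraded modules and maps, so the shift is harmless. -/
theorem IsStableAt.of_hasPeriodicity {p i : ℕ} (hp : HasPeriodicity Q p)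
    (hQ : IsStableAt Q (i + p)) : IsStableAt Q i := by
  obtain ⟨n, t, ht⟩ := hp
  unfold IsStableAt coker at hQ
  rw [show i + p + 1 = i + 1 + p by omega] at hQ
  let l : (Q.X (i + p)).carrier ≃ₗ[Hypersurface f] (Q.X i).carrier :=
    LinearEquiv.ofBijective (t i).hom.lin (iso_bijective (t i))
  have hcomm : ∀ x, (Q.d (i + 1) i).lin ((t (i + 1)).hom.lin x) =
      l ((Q.d (i + 1 + p) (i + p)).lin x) :=
    fun x => DFunLike.congr_fun (congrArg Hom.lin (ht i)) x
  refine ⟨overA_hasProjectiveDimensionLT_of_equiv (Submodule.Quotient.equiv _ _ l ?_) hQ.1,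
    fun π hπ hsurj => hQ.2 (π.comp l.toLinearMap) (fun x => ?_) (hsurj.comp l.surjective)⟩
  · ext y
    constructor
    · rintro ⟨_, ⟨x, rfl⟩, rfl⟩
      exact ⟨(t (i + 1)).hom.lin x, hcomm x⟩
    · rintro ⟨y, rfl⟩
      obtain ⟨x, rfl⟩ := (iso_bijective (t (i + 1))).2 y
      exact ⟨_, ⟨x, rfl⟩, (hcomm x).symm⟩
  · exact (congrArg π (hcomm x)).symm.trans (hπ _)

theorem exists_isPeriodicOfPeriod {p : ℕ} (hp : 0 < p) (h : HasPeriodicity Q p) :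
    ∃ q ≤ p, IsPeriodicOfPeriod Q q := by
  classical
  have hex : ∃ q, 0 < q ∧ HasPeriodicity Q q := ⟨p, hp, h⟩
  exact ⟨Nat.find hex, Nat.find_min' hex ⟨hp, h⟩, Nat.find_spec hex,
    fun q hq => Nat.find_min' hex hq⟩

variable {M : GrMod (Hypersurface.grading 𝒜 f)} {ε : Q.X 0 ⟶ M}

/-- The resolved module is the cokernel of the first differential. -/
theorem IsMinimalFreeResolution.exists_cokerEquiv (hQ : IsMinimalFreeResolution Q ε) :
    Nonempty (coker Q 0 ≃ₗ[Hypersurface f] M.carrier) :=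
  ⟨(Submodule.quotEquivOfEq _ _ hQ.exact_zero.symm).trans
    (ε.lin.quotKerEquivOfSurjective hQ.surjective)⟩

/-- Multiplication by `f` is zero on a `B`-module but injective on a projective `A`-module. -/
theorem not_hasProjectiveDimensionLT_one_overA (h : IsNormalRegular 𝒜 f e) {X : Type u}
    [AddCommGroup X] [Module (Hypersurface f) X] [Nontrivial X] :
    ¬ HasProjectiveDimensionLT (overA f X) 1 := by
  intro hX
  rw [← projective_iff_hasProjectiveDimensionLT_one, ← IsProjective.iff_projective] at hX
  obtain ⟨x, hx⟩ := exists_ne (0 : X)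
  have hf : ∀ y : X, f • (show overA f X from y) = 0 := by
    intro y
    change Hypersurface.mk f f • y = 0
    rw [h.mk_self, zero_smul]
  exact hx (h.smul_injective (M := overA f X) ((hf x).trans (hf 0).symm))

theorem IsMinimalFreeResolution.pdOver_eq_one (h : IsNormalRegular 𝒜 f e)
    (hQ : IsMinimalFreeResolution Q ε) [Nontrivial M.carrier] (hst : IsStableAt Q 0) :
    M.pdOver = 1 := by
  obtain ⟨t⟩ := hQ.exists_cokerEquiv
  have h1 := overA_hasProjectiveDimensionLT_of_equiv t hst.1
  refine le_antisymm ((projectiveDimension_le_iff (overA f M.carrier) 1).2 h1)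
    ((projectiveDimension_ge_iff (overA f M.carrier) 1).2 ?_)
  exact not_hasProjectiveDimensionLT_one_overA h

theorem IsMinimalFreeResolution.not_hasFreeSummand (hQ : IsMinimalFreeResolution Q ε)
    (hst : IsStableAt Q 0) : ¬ M.HasFreeSummand := by
  intro hM
  obtain ⟨π, hπ⟩ := hM.exists_surjective
  refine hst.2 (π.comp ε.lin) (fun x => ?_) (hπ.comp hQ.surjective)
  have h1 : ε.lin ((Q.d 1 0).lin x) = 0 := hQ.exact_zero.ge ⟨x, rfl⟩
  rw [LinearMap.comp_apply, h1, map_zero]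

variable [GradedAlgebra 𝒜]

/-- The dimension bound holds from index `d` on; the absence of surjections onto `B` is inherited
from the preceding index, which is why `i > d` is required. -/
theorem IsMinimalAcyclic.isStableAt (hA : IsConnectedLocallyFinite 𝒜)
    (h : IsNormalRegular 𝒜 f e) (hQ : IsMinimalAcyclic Q) {d : ℕ}
    (hd : leftGlobalDimension A = d) {i : ℕ} (hi : d < i) : IsStableAt Q i := by
  have key : ∀ j, d ≤ j → HasProjectiveDimensionLT (overA f (coker Q j)) 2 := by
    intro j hj
    have := hQ.hasProjectiveDimensionLT_coker h hd j
    rwa [show max 2 (d + 1 - j) = 2 by omega] at this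
  obtain ⟨j, rfl⟩ : ∃ j, i = j + 1 := ⟨i - 1, by omega⟩
  exact ⟨key _ hi.le, hQ.not_surjective hA h j (key j (by omega))⟩

theorem basis_red_reg (hA : IsConnectedLocallyFinite 𝒜) (h : IsNormalRegular 𝒜 f e) (n : ℤ) :
    Nonempty (Module.Basis PUnit.{u + 1} (Hypersurface f) (h.red ((reg 𝒜).shift n)).carrier) ∧
      Nontrivial (h.red ((reg 𝒜).shift n)).carrier := by
  have := h.nontrivial_hypersurface hA
  obtain ⟨b, -⟩ := h.exists_redBasis (M := (reg 𝒜).shift n) (Module.Basis.singleton PUnit A)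
  exact ⟨⟨b⟩, ⟨b PUnit.unit, 0, b.ne_zero _⟩⟩

theorem IsMinimalAcyclic.exists_iso_Omega [IsNoetherianRing A] (hA : IsConnectedLocallyFinite 𝒜)
    (h : IsNormalRegular 𝒜 f e) (hQ : IsMinimalAcyclic Q)
    (hpd : HasProjectiveDimensionLT (overA f (coker Q 0)) 2)
    (hnf : ∀ (n : ℤ) (π : Q.X 0 ⟶ h.red ((reg 𝒜).shift n)), Q.d 1 0 ≫ π = 0 →
      ¬ Function.Surjective π.lin) :
    ∃ T : TwistedMF h, T.IsMinimal ∧ Nonempty (Q ≅ T.Omega) := by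
  have : IsNoetherianRing (Hypersurface f) :=
    isNoetherianRing_of_surjective A _ (Hypersurface.mk f) Ideal.Quotient.mk_surjective
  obtain ⟨T, hT, s, hs⟩ := hQ.exists_twistedMF hA h hpd hnf
  refine ⟨T, hT, hQ.exists_iso (h.isAugmented_grading hA) hT.isMinimalAcyclic s ?_⟩
  rw [TwistedMF.Omega_d]
  exact hs

theorem IsMinimalAcyclic.exists_iso_Omega_of_isStableAt [IsNoetherianRing A]
    (hA : IsConnectedLocallyFinite 𝒜) (h : IsNormalRegular 𝒜 f e) (hQ : IsMinimalAcyclic Q)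
    (hst : IsStableAt Q 0) : ∃ T : TwistedMF h, T.IsMinimal ∧ Nonempty (Q ≅ T.Omega) := by
  refine hQ.exists_iso_Omega hA h hst.1 fun n π hπ hsurj => ?_
  obtain ⟨⟨b⟩, -⟩ := basis_red_reg hA h n
  exact hst.2 ((b.coord PUnit.unit).comp π.lin)
    (fun x => (congrArg (b.coord PUnit.unit)
      (DFunLike.congr_fun (congrArg Hom.lin hπ) x)).trans (map_zero _))
    ((exists_surjective_of_basis b _).comp hsurj)

/-- Stability holds far out and is carried down to index 0 in steps of `p`. -/
theorem IsMinimalAcyclic.isStableAt_zero_of_isPeriodic (hA : IsConnectedLocallyFinite 𝒜)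
    (h : IsNormalRegular 𝒜 f e) (hQ : IsMinimalAcyclic Q) {d : ℕ}
    (hd : leftGlobalDimension A = d) (hp : IsPeriodic Q) : IsStableAt Q 0 := by
  obtain ⟨p, ⟨hp0, hp⟩, -⟩ := hp
  have key : ∀ m, ∀ i, d < i + m * p → IsStableAt Q i := by
    intro m
    induction m with
    | zero =>
      intro i hi
      exact hQ.isStableAt hA h hd (by simpa using hi)
    | succ m ih =>
      intro i hi
      refine IsStableAt.of_hasPeriodicity hp (ih (i + p) ?_)
      rwa [add_assoc, add_comm p, ← Nat.succ_mul]
  -- Since `p ≥ 1`, `d + 1` periods reach beyond index `d`.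
  refine key (d + 1) 0 ?_
  nlinarith

/-- A graded surjection from `Q_0` onto a shift of `B` that kills the image of `Q_1` descends to `M`
and splits there, contradicting the absence of free summands. -/
theorem IsMinimalFreeResolution.exists_iso_Omega [IsNoetherianRing A]
    (hA : IsConnectedLocallyFinite 𝒜) (h : IsNormalRegular 𝒜 f e)
    (hQ : IsMinimalFreeResolution Q ε) (hQ' : IsMinimalAcyclic Q) (hpd : M.pdOver = 1)
    (hM : ¬ M.HasFreeSummand) : ∃ T : TwistedMF h, T.IsMinimal ∧ Nonempty (Q ≅ T.Omega) := by
  obtain ⟨t⟩ := hQ.exists_cokerEquiv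
  have h1 : HasProjectiveDimensionLT (overA f M.carrier) 2 :=
    (projectiveDimension_le_iff (overA f M.carrier) 1).1 hpd.le
  refine hQ'.exists_iso_Omega hA h (overA_hasProjectiveDimensionLT_of_equiv t.symm h1)
    fun n π hπ hsurj => hM ?_
  obtain ⟨g, hg⟩ := exists_desc ε hQ.surjective π (by
    rw [hQ.exact_zero]
    rintro _ ⟨x, rfl⟩
    exact DFunLike.congr_fun (congrArg Hom.lin hπ) x)
  obtain ⟨-, hb⟩ := basis_red_reg hA h n
  refine hasFreeSummand_of_surjective (h.isAugmented_grading hA)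
    (h.red_isFree ((isFree_reg 𝒜).shift n)) hb g ?_
  subst hg
  exact Function.Surjective.of_comp hsurj

end

end GrMod

/-! ### The main theorem -/

theorem mainTheorem1 {k : Type v} [Field k] {A : Type u} [Ring A] [Algebra k A]
    (𝒜 : ℕ → Submodule k A) [GradedAlgebra 𝒜] (hA : IsConnectedLocallyFinite 𝒜)
    [IsNoetherianRing A] (d : ℕ) (hd : IsASRegular 𝒜 d)
    {f : A} {e : ℕ} (hf : IsNormalRegular 𝒜 f e)
    (M : GrMod (Hypersurface.grading 𝒜 f)) (hM : Module.Finite (Hypersurface f) M.carrier)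
    (Q : ChainComplex (GrMod (Hypersurface.grading 𝒜 f)) ℕ) (ε : Q.X 0 ⟶ M)
    (hQ : GrMod.IsMinimalFreeResolution Q ε) :
    (∃ T : TwistedMF hf, T.IsReduced ∧ Nonempty (GrMod.truncation Q (d + 1) ≅ T.Omega)) ∧
    (IsOfFinOrder hf.sigma →
      (∃ p ≤ 2 * orderOf hf.sigma,
        GrMod.IsPeriodicOfPeriod (GrMod.truncation Q (d + 1)) p) ∧
      (Nontrivial M.carrier →
        ((GrMod.IsPeriodic Q ↔ M.pdOver = 1 ∧ ¬ M.HasFreeSummand) ∧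
          ((∃ p ≤ 2 * orderOf hf.sigma, GrMod.IsPeriodicOfPeriod Q p) ↔
            M.pdOver = 1 ∧ ¬ M.HasFreeSummand))) ∧
      (GrMod.IsPeriodic Q →
        ∃ T : TwistedMF hf, T.IsReduced ∧ Nonempty (Q ≅ T.Omega))) := by
  have : IsNoetherianRing (Hypersurface f) :=
    isNoetherianRing_of_surjective A _ (Hypersurface.mk f) Ideal.Quotient.mk_surjective
  have hgl := hd.globalDimension
  have hQ' := hQ.isMinimalAcyclic (hf.isAugmented_grading hA) hM
  obtain ⟨T, hT, ⟨t⟩⟩ := (hQ'.truncation (d + 1)).exists_iso_Omega_of_isStableAt hA hf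
    (hQ'.isStableAt hA hf hgl (by omega)).truncation
  refine ⟨⟨T, hT.isReduced hA, ⟨t⟩⟩, fun hσ => ?_⟩
  have hpos : 0 < 2 * orderOf hf.sigma := Nat.mul_pos two_pos hσ.orderOf_pos
  refine ⟨GrMod.exists_isPeriodicOfPeriod hpos ((hT.hasPeriodicity hA).of_iso t.symm),
    fun _ => ?_, fun hper => ?_⟩
  · have h1 : GrMod.IsPeriodic Q → M.pdOver = 1 ∧ ¬ M.HasFreeSummand := fun hper =>
      have hst := hQ'.isStableAt_zero_of_isPeriodic hA hf hgl hper
      ⟨hQ.pdOver_eq_one hf hst, hQ.not_hasFreeSummand hst⟩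
    have h2 : M.pdOver = 1 ∧ ¬ M.HasFreeSummand →
        ∃ p ≤ 2 * orderOf hf.sigma, GrMod.IsPeriodicOfPeriod Q p := by
      rintro ⟨hpd, hns⟩
      obtain ⟨T', hT', ⟨t'⟩⟩ := hQ.exists_iso_Omega hA hf hQ' hpd hns
      exact GrMod.exists_isPeriodicOfPeriod hpos ((hT'.hasPeriodicity hA).of_iso t'.symm)
    have h3 : (∃ p ≤ 2 * orderOf hf.sigma, GrMod.IsPeriodicOfPeriod Q p) →
        GrMod.IsPeriodic Q := fun ⟨p, _, hp⟩ => ⟨p, hp⟩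
    exact ⟨⟨h1, fun h => h3 (h2 h)⟩, ⟨fun h => h1 (h3 h), h2⟩⟩
  · obtain ⟨T', hT', hiso⟩ := hQ'.exists_iso_Omega_of_isStableAt hA hf
      (hQ'.isStableAt_zero_of_isPeriodic hA hf hgl hper)
    exact ⟨T', hT'.isReduced hA, hiso⟩
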